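/- **Setting.** All Lie algebras and modules are over $\mathbb C$. Let $\mathfrak g=\mathfrak{sl}_2$ with standard basis $e,h,f$. For $n\ge 0$ let $L(n)$ be the simple $(n+1)$-dimensional $\mathfrak g$-module with basis $v_n,v_{n-2},\dots,v_{-n}$ satisfying $$h v_{n-2j}=(n-2j)v_{n-2j},\qquad e v_{n-2j}=(n-j+1)v_{n-2j+2},\qquad f v_{n-2j}=(j+1)v_{n-2j-2}\qquad(0\le j\le n),$$ where $v_{n+2}=v_{-n-2}=0$. Let $\mathfrak L^3=\mathfrak g\ltimes L(3)$, with $L(3)$ an abelian ideal. Put $Q(0)=U(\mathfrak L^3)\otimes_{U(\mathfrak g)}L(0)$ and, for $\chi\in\mathbb C$, $Q(0,\chi)=Q(0)/(C-\chi)Q(0)$, where $C\in U(\mathfrak L^3)$ is the cubic discriminant $$C=v_{-1}^2v_1^2-27v_{-3}^2v_3^2-4v_{-1}^3v_3-4v_{-3}v_1^3+18v_{-3}v_{-1}v_1v_3 .$$ An $\mathfrak L^3$-module is called *$\mathfrak g$-Harish-Chandra* if its restriction to $\mathfrak g$ is a direct sum of simple finite-dimensional $\mathfrak g$-modules in which every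 isomorphism class occurs with finite multiplicity. The multiplicity of a simple finite-dimensional $\mathfrak g$-module $S$ in such a module $M$, that is, the number of summands isomorphic to $S$ in a decomposition into simple modules, is written $[M:S]$. **Proposition.** Let $\chi\in\mathbb C$, $\chi\neq 0$. Then $Q(0,\chi)$ is $\mathfrak g$-Harish-Chandra, and for every integer $k\ge 0$ (and for every decomposition of $Q(0,\chi)$ into simple finite-dimensional $\mathfrak g$-modules) $$[Q(0,\chi):L(k)]=k-2\left\lfloor\frac{k+2}{3}\right\rfloor+1 .$$ Moreover, $Q(0,\chi)$ has a simple quotient which is an infinite-dimensional $\mathfrak g$-Harish-Chandra module. Hence $\mathfrak L^3$ has infinite-dimensional simple $\mathfrak g$-Harish-Chandra modules, although $[\mathfrak L^3,\mathfrak r]\cap\mathfrak r_0=0$, where $\mathfrak r$ is the radical of $\mathfrak L^3$ and, for any choice of a Cartan subalgebra $\mathfrak h\subset\mathfrak g$, $\mathfrak r_0=\{x\in\mathfrak r:[\mathfrak h,x]=0\}$ is its zero weight space. -/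

import Mathlib

open scoped TensorProduct

noncomputable section

namespace HarishChandra

/-! ### Induced modules -/

section Induced

variable {g L : Type} [LieRing g] [LieAlgebra ℂ g] [LieRing L] [LieAlgebra ℂ L]

/-- The relations `(u x) ⊗ m = u ⊗ (x m)`, for `u ∈ U(L)`, `x ∈ g`, `m ∈ M`, as a
`U(L)`-submodule of `U(L) ⊗ M` (tensor product over `ℂ`). As `g` generates `U(g)`, the quotient by
it is the tensor product over `U(g)`. -/
def inductionRelations (i : g →ₗ⁅ℂ⁆ L) (M : Type) [AddCommGroup M] [Module ℂ M]
    [LieRingModule g M] :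
    Submodule (UniversalEnvelopingAlgebra ℂ L) (UniversalEnvelopingAlgebra ℂ L ⊗[ℂ] M) :=
  Submodule.span (UniversalEnvelopingAlgebra ℂ L)
    {t | ∃ (u : UniversalEnvelopingAlgebra ℂ L) (x : g) (m : M),
      t = (u * UniversalEnvelopingAlgebra.ι ℂ (i x)) ⊗ₜ[ℂ] m - u ⊗ₜ[ℂ] ⁅x, m⁆}

/-- The induced module `U(L) ⊗_{U(g)} M`, for a homomorphism of Lie algebras `i : g → L`. -/
abbrev Induced (i : g →ₗ⁅ℂ⁆ L) (M : Type) [AddCommGroup M] [Module ℂ M] [LieRingModule g M] :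
    Type :=
  (UniversalEnvelopingAlgebra ℂ L ⊗[ℂ] M) ⧸ inductionRelations i M

/-- For a `U(L)`-module `Q` and an element `z` of `U(L)`, the `U(L)`-submodule generated by
`z Q`; it is `z Q` itself when `z` is central. -/
def mulSubmodule (z : UniversalEnvelopingAlgebra ℂ L) (Q : Type) [AddCommGroup Q]
    [Module (UniversalEnvelopingAlgebra ℂ L) Q] : Submodule (UniversalEnvelopingAlgebra ℂ L) Q :=
  Submodule.span (UniversalEnvelopingAlgebra ℂ L) (Set.range fun q : Q => z • q)

end Induced

/-! ### Restriction and Harish-Chandra modules -/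

section Restriction

variable {g L : Type} [LieRing g] [LieAlgebra ℂ g] [LieRing L] [LieAlgebra ℂ L]

/-- The `L`-module `M` regarded as a `g`-module along `i : g → L`. -/
def Res (_i : g →ₗ⁅ℂ⁆ L) (M : Type) : Type := M

variable (i : g →ₗ⁅ℂ⁆ L) (M : Type) [AddCommGroup M] [Module ℂ M] [LieRingModule L M]
  [LieModule ℂ L M]

instance : AddCommGroup (Res i M) := inferInstanceAs (AddCommGroup M)

instance : Module ℂ (Res i M) := inferInstanceAs (Module ℂ M)

instance : LieRingModule g (Res i M) := LieRingModule.compLieHom M i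

instance : LieModule ℂ g (Res i M) := LieModule.compLieHom M i

/-- The set `s` of submodules exhibits the `g`-module `M` as the (internal) direct sum of simple
finite-dimensional `g`-modules. -/
structure IsSimpleDecomposition {M : Type} [AddCommGroup M] [Module ℂ M] [LieRingModule g M]
    [LieModule ℂ g M] (s : Set (LieSubmodule ℂ g M)) : Prop where
  irreducible : ∀ N ∈ s, LieModule.IsIrreducible ℂ g N
  finite : ∀ N ∈ s, Module.Finite ℂ N
  indep : sSupIndep s
  sSup_eq_top : sSup s = ⊤

/-- The summands of the family `s` that are isomorphic to the `g`-module `S`. -/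
def summandsOfType {M : Type} [AddCommGroup M] [Module ℂ M] [LieRingModule g M]
    [LieModule ℂ g M] (s : Set (LieSubmodule ℂ g M)) (S : Type) [AddCommGroup S] [Module ℂ S]
    [LieRingModule g S] : Set (LieSubmodule ℂ g M) :=
  {N ∈ s | Nonempty (N ≃ₗ⁅ℂ,g⁆ S)}

/-- The `L`-module `M` is `g`-Harish-Chandra: its restriction to `g` is a direct sum of simple
finite-dimensional `g`-modules, in which every isomorphism class occurs finitely many times. -/
def IsHarishChandra : Prop :=
  ∃ s : Set (LieSubmodule ℂ g (Res i M)), IsSimpleDecomposition s ∧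
    ∀ N ∈ s, (summandsOfType s N).Finite

/-- The weight space of weight zero of the radical of `L`, for a subalgebra `𝔥` of `g`. -/
def radicalZeroWeightSpace (i : g →ₗ⁅ℂ⁆ L) (𝔥 : LieSubalgebra ℂ g) : Submodule ℂ L where
  carrier := {x | x ∈ LieAlgebra.radical ℂ L ∧ ∀ h ∈ 𝔥, ⁅i h, x⁆ = 0}
  add_mem' := fun ha hb => ⟨add_mem ha.1 hb.1, fun h hh => by
    rw [lie_add, ha.2 h hh, hb.2 h hh, add_zero]⟩
  zero_mem' := ⟨zero_mem _, fun _ _ => lie_zero _⟩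
  smul_mem' := fun c _ hx => ⟨(LieAlgebra.radical ℂ L).smul_mem c hx.1, fun h hh => by
    rw [lie_smul, hx.2 h hh, smul_zero]⟩

end Restriction

/-! ### The simple modules of `sl₂` -/

/-- The Lie algebra of traceless complex `2 × 2` matrices. -/
abbrev Sl2 : Type := LieAlgebra.SpecialLinear.sl (Fin 2) ℂ

/-- The underlying space of the simple `sl₂`-module `L(n)` of dimension `n + 1`. The coordinate
with index `j` belongs to a basis vector `v_{n - 2j}` of weight `n - 2j`. -/
def Irrep (n : ℕ) : Type := Fin (n + 1) → ℂ

namespace Irrep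

variable (n : ℕ)

instance : AddCommGroup (Irrep n) := inferInstanceAs (AddCommGroup (Fin (n + 1) → ℂ))

instance : Module ℂ (Irrep n) := inferInstanceAs (Module ℂ (Fin (n + 1) → ℂ))

variable {n} in
/-- The coordinate of `w` at `v_{n - 2k}`, read as zero for `k > n`. -/
def coord (w : Irrep n) (k : ℕ) : ℂ := if hk : k < n + 1 then w ⟨k, hk⟩ else 0

variable {n} in
/-- The action of `!![a, b; c, -a]`, that is of `a h + b e + c f`, where
`h v_{n - 2j} = (n - 2j) v_{n - 2j}`, `e v_{n - 2j} = (n - j + 1) v_{n - 2j + 2}` and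
`f v_{n - 2j} = (j + 1) v_{n - 2j - 2}`, with `v_{n + 2} = v_{-n - 2} = 0`. -/
def act (x : Sl2) (w : Irrep n) : Irrep n := fun j =>
  x.1 0 0 * (((n : ℂ) - 2 * (j.1 : ℂ)) * coord w j.1)
    + x.1 0 1 * (((n : ℂ) - (j.1 : ℂ)) * coord w (j.1 + 1))
    + x.1 1 0 * ((j.1 : ℂ) * coord w (j.1 - 1))

theorem coord_add (v w : Irrep n) (k : ℕ) : coord (v + w) k = coord v k + coord w k := by
  unfold coord
  split_ifs
  · rfl
  · exact (add_zero 0).symm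

theorem coord_smul (c : ℂ) (w : Irrep n) (k : ℕ) : coord (c • w) k = c * coord w k := by
  unfold coord
  split_ifs
  · rfl
  · exact (mul_zero c).symm

theorem coord_act (x : Sl2) (w : Irrep n) (k : ℕ) (hk : k < n + 1) :
    coord (act x w) k = x.1 0 0 * (((n : ℂ) - 2 * (k : ℂ)) * coord w k)
      + x.1 0 1 * (((n : ℂ) - (k : ℂ)) * coord w (k + 1))
      + x.1 1 0 * ((k : ℂ) * coord w (k - 1)) := by
  rw [coord, dif_pos hk]
  rfl

theorem act_lie (x y : Sl2) (w : Irrep n) : act ⁅x, y⁆ w = act x (act y w) - act y (act x w) := by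
  have tr : ∀ z : Sl2, z.1 1 1 = -z.1 0 0 := fun z => by
    have h : z.1 0 0 + z.1 1 1 = 0 := by
      simpa [LieAlgebra.SpecialLinear.sl, Matrix.trace_fin_two] using z.2
    linear_combination h
  funext ⟨j, hj⟩
  change act _ w _ = act _ (act _ w) _ - act _ (act _ w) _
  have up : ∀ z : Sl2, ((n : ℂ) - (j : ℂ)) * coord (act z w) (j + 1) = ((n : ℂ) - (j : ℂ)) *
      (z.1 0 0 * (((n : ℂ) - 2 * ((j : ℂ) + 1)) * coord w (j + 1))
        + z.1 0 1 * (((n : ℂ) - ((j : ℂ) + 1)) * coord w (j + 2))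
        + z.1 1 0 * (((j : ℂ) + 1) * coord w j)) := fun z => by
    rcases Nat.lt_or_ge (j + 1) (n + 1) with h | h
    · rw [coord_act n z w _ h]
      push_cast
      rfl
    · obtain rfl : j = n := by omega
      simp
  have down : ∀ z : Sl2, (j : ℂ) * coord (act z w) (j - 1) = (j : ℂ) *
      (z.1 0 0 * (((n : ℂ) - 2 * ((j : ℂ) - 1)) * coord w (j - 1))
        + z.1 0 1 * (((n : ℂ) - ((j : ℂ) - 1)) * coord w j)
        + z.1 1 0 * (((j : ℂ) - 1) * coord w (j - 2))) := fun z => by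
    rcases j with _ | i
    · simp
    · rw [coord_act n z w _ (by omega)]
      have h1 : i + 1 - 1 = i := by omega
      have h2 : i + 1 - 2 = i - 1 := by omega
      rw [h1, h2]
      push_cast
      ring
  simp only [act, up, down, coord_act n _ w j hj, LieAlgebra.SpecialLinear.sl_bracket,
    Matrix.sub_apply, Matrix.mul_apply, Fin.sum_univ_two, tr]
  ring

instance : LieRingModule Sl2 (Irrep n) where
  bracket := act
  add_lie x y w := by
    funext j
    change act (x + y) w j = act x w j + act y w j
    have h : ∀ a b, (x + y).1 a b = x.1 a b + y.1 a b := fun _ _ => rfl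
    simp only [act, h]
    ring
  lie_add x v w := by
    funext j
    change act x (v + w) j = act x v j + act x w j
    simp only [act, coord_add]
    ring
  leibniz_lie x y w := by
    change act x (act y w) = act ⁅x, y⁆ w + act y (act x w)
    rw [act_lie, sub_add_cancel]

instance : LieModule ℂ Sl2 (Irrep n) where
  smul_lie c x w := by
    funext j
    change act (c • x) w j = c * act x w j
    have h : ∀ a b, (c • x).1 a b = c * x.1 a b := fun _ _ => rfl
    simp only [act, h]
    ring
  lie_smul c x w := by
    funext j
    change act x (c • w) j = c * act x w j
    simp only [act, coord_smul]
    ring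

/-- `L(n)` as an abelian Lie algebra. -/
instance : LieRing (Irrep n) where
  bracket _ _ := 0
  add_lie _ _ _ := (add_zero 0).symm
  lie_add _ _ _ := (add_zero 0).symm
  lie_self _ := rfl
  leibniz_lie _ _ _ := (add_zero 0).symm

instance : LieAlgebra ℂ (Irrep n) where
  lie_smul c _ _ := (smul_zero c).symm

/-- The action of `sl₂` on the abelian Lie algebra `L(n)` by derivations. -/
def derivation : Sl2 →ₗ⁅ℂ⁆ LieDerivation ℂ (Irrep n) (Irrep n) where
  toFun x :=
    { toLinearMap := LieModule.toEnd ℂ Sl2 (Irrep n) x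
      leibniz' := fun _ _ => (lie_zero x).trans (sub_zero 0).symm }
  map_add' x y := by
    ext w : 1
    exact add_lie x y w
  map_smul' c x := by
    ext w : 1
    exact smul_lie c x w
  map_lie' {x y} := by
    ext w : 1
    exact lie_lie x y w

end Irrep

/-! ### Conformal Galilei algebras -/

/-- The conformal Galilei algebra `L^n = sl₂ ⋉ L(n)`. -/
abbrev Galilei (n : ℕ) : Type :=
  LieAlgebra.SemiDirectSum (Irrep n) Sl2 (Irrep.derivation n)

/-- The inclusion of `sl₂` in `L^n`. -/
abbrev sl2Incl (n : ℕ) : Sl2 →ₗ⁅ℂ⁆ Galilei n :=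
  LieAlgebra.SemiDirectSum.inr (Irrep.derivation n)

/-- The basis vector `v_{n - 2j}` of the ideal `L(n)` of `L^n`, in the universal enveloping algebra
of `L^n`. -/
def radVec (n : ℕ) (j : Fin (n + 1)) : UniversalEnvelopingAlgebra ℂ (Galilei n) :=
  UniversalEnvelopingAlgebra.ι ℂ
    (LieAlgebra.SemiDirectSum.inl (Irrep.derivation n) (Pi.single j 1 : Fin (n + 1) → ℂ))

/-- The cubic discriminant, in terms of `v_3, v_1, v_{-1}, v_{-3}`. -/
def cubicDiscriminant : UniversalEnvelopingAlgebra ℂ (Galilei 3) :=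
  let v₃ := radVec 3 0
  let v₁ := radVec 3 1
  let w₁ := radVec 3 2
  let w₃ := radVec 3 3
  w₁ ^ 2 * v₁ ^ 2 - 27 * w₃ ^ 2 * v₃ ^ 2 - 4 * w₁ ^ 3 * v₃ - 4 * w₃ * v₁ ^ 3
    + 18 * w₃ * w₁ * v₁ * v₃

/-- `Q(0) = U(L^3) ⊗_{U(sl₂)} L(0)`. -/
abbrev Q0 : Type := Induced (sl2Incl 3) (Irrep 0)

/-- `Q(0, χ) = Q(0) / (C - χ) Q(0)`, where `C` is the cubic discriminant. -/
def Q0χ (χ : ℂ) : Type :=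
  Q0 ⧸ mulSubmodule (cubicDiscriminant - algebraMap ℂ _ χ) Q0

namespace Q0χ

variable (χ : ℂ)

instance : AddCommGroup (Q0χ χ) := inferInstanceAs (AddCommGroup (Q0 ⧸ mulSubmodule _ Q0))

instance : Module (UniversalEnvelopingAlgebra ℂ (Galilei 3)) (Q0χ χ) :=
  inferInstanceAs (Module _ (Q0 ⧸ mulSubmodule _ Q0))

instance : Module ℂ (Q0χ χ) := inferInstanceAs (Module ℂ (Q0 ⧸ mulSubmodule _ Q0))

instance : IsScalarTower ℂ (UniversalEnvelopingAlgebra ℂ (Galilei 3)) (Q0χ χ) :=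
  inferInstanceAs (IsScalarTower ℂ _ (Q0 ⧸ mulSubmodule _ Q0))

/-- `L^3` acts through its universal enveloping algebra. -/
instance : LieRingModule (Galilei 3) (Q0χ χ) where
  bracket x q := UniversalEnvelopingAlgebra.ι ℂ x • q
  add_lie x y q := by
    change UniversalEnvelopingAlgebra.ι ℂ (x + y) • q = _
    rw [map_add, add_smul]
  lie_add x p q := smul_add _ p q
  leibniz_lie x y q := by
    change UniversalEnvelopingAlgebra.ι ℂ x • UniversalEnvelopingAlgebra.ι ℂ y • q =
      UniversalEnvelopingAlgebra.ι ℂ ⁅x, y⁆ • q +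
        UniversalEnvelopingAlgebra.ι ℂ y • UniversalEnvelopingAlgebra.ι ℂ x • q
    let _ := LieRing.ofAssociativeRing (A := UniversalEnvelopingAlgebra ℂ (Galilei 3))
    rw [LieHom.map_lie, LieRing.of_associative_ring_bracket, sub_smul, mul_smul, mul_smul,
      sub_add_cancel]

instance : LieModule ℂ (Galilei 3) (Q0χ χ) where
  smul_lie c x q := by
    change UniversalEnvelopingAlgebra.ι ℂ (c • x) • q = c • UniversalEnvelopingAlgebra.ι ℂ x • q
    rw [map_smul, smul_assoc]
  lie_smul c x q := smul_comm (UniversalEnvelopingAlgebra.ι ℂ x) c q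

end Q0χ

end HarishChandra

end

/-! The module `Q(0)` is the symmetric algebra of `L(3)`, the ring of polynomials in the
coefficients of a binary cubic: `L(3)` acts by multiplication and `sl₂` by derivations. A linear map
from polynomials to `Q(0)` is onto because `sl₂` kills the generator, and is injective because the
polynomial ring is itself an `L³`-module (`polyToQ0_surjective`, `polyToQ0_injective`). The
discriminant is `sl₂`-invariant, so `Q(0, χ)` is the quotient of the polynomial ring by the ideal
`(D - χ)` (`polyToQ0χ_eq_zero_iff`).

This module is integrable: weight vectors span it and `e`, `f` act locally nilpotently. Over `sl₂`
that forces a decomposition into copies of the `L(k)`, with multiplicities equal to the dimensions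
of the spaces of highest weight vectors (`IsIntegrable.exists_decomposition`,
`IsSimpleDecomposition.ncard_summandsOfType`). The tool is the extremal projector, which lifts
highest weight vectors along surjections (`IsIntegrable.exists_highestWeight_lift`).

By this lifting, highest weight vectors of `Q(0, χ)` come from seminvariants of the cubic. These are
generated by the leading coefficient `v₃`, the Hessian seminvariant `H`, the cubic seminvariant `T`
and `D`, with `T² = 4H³ - 27 v₃² D` (`isCovariantForm_of_lie_e`). Modulo `D - χ` a basis is `v₃ⁱHʲ`,
`T v₃ⁱHʲ`, of weights `3i + 2j` and `3i + 2j + 3` (`eq_zero_of_disc_sub_dvd`), and counting gives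
the formula.

The module is cyclic and nonzero, hence has a maximal submodule. The corresponding submodule of the
polynomial ring is an ideal; if its quotient were finite-dimensional, its radical would contain
every variable, hence `D`, hence the nonzero constant `χ`, which is absurd.

The radical of `L³` lies in `L(3)`. A Cartan subalgebra of `sl₂` contains an element of nonzero
determinant, which acts invertibly on `L(3)` because the weights of `L(3)` are odd. So already the
zero weight space of the radical vanishes. -/

noncomputable section

namespace HarishChandra

/-! ### Generalities on `sl₂`-modules -/

namespace Sl2

/-- The upper triangular nilpotent standard generator of `sl₂`. -/
def e : Sl2 := ⟨!![0, 1; 0, 0], by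
  simp [LieAlgebra.SpecialLinear.sl, Matrix.trace_fin_two]⟩

/-- The lower triangular nilpotent standard generator of `sl₂`. -/
def f : Sl2 := ⟨!![0, 0; 1, 0], by
  simp [LieAlgebra.SpecialLinear.sl, Matrix.trace_fin_two]⟩

/-- The diagonal standard generator of `sl₂`. -/
def h : Sl2 := ⟨!![1, 0; 0, -1], by
  simp [LieAlgebra.SpecialLinear.sl, Matrix.trace_fin_two]⟩

theorem apply_one_one (x : Sl2) : x.1 1 1 = -x.1 0 0 := by
  have h : x.1 0 0 + x.1 1 1 = 0 := by
    simpa [LieAlgebra.SpecialLinear.sl, Matrix.trace_fin_two] using x.2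
  linear_combination h

theorem ext_entries {x y : Sl2} (h₀ : x.1 0 0 = y.1 0 0) (h₁ : x.1 0 1 = y.1 0 1)
    (h₂ : x.1 1 0 = y.1 1 0) : x = y := by
  apply Subtype.ext
  ext i j
  fin_cases i <;> fin_cases j
  · exact h₀
  · exact h₁
  · exact h₂
  · change x.1 1 1 = y.1 1 1
    rw [apply_one_one, apply_one_one, h₀]

theorem eq_combination (x : Sl2) : x = x.1 0 0 • h + x.1 0 1 • e + x.1 1 0 • f := by
  apply ext_entries
  all_goals
    change _ = x.1 0 0 * _ + x.1 0 1 * _ + x.1 1 0 * _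
    simp [h, e, f]

theorem lie_e_f : ⁅e, f⁆ = h := by
  apply ext_entries <;> rw [LieAlgebra.SpecialLinear.sl_bracket] <;> simp [h, e, f]

theorem lie_h_e : ⁅h, e⁆ = (2 : ℂ) • e := by
  apply ext_entries <;> rw [LieAlgebra.SpecialLinear.sl_bracket]
  all_goals
    change _ = (2 : ℂ) * _
    simp [h, e]
  norm_num

theorem lie_h_f : ⁅h, f⁆ = (-2 : ℂ) • f := by
  apply ext_entries <;> rw [LieAlgebra.SpecialLinear.sl_bracket]
  all_goals
    change _ = (-2 : ℂ) * _
    simp [h, f]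
  norm_num

end Sl2

theorem lie_h_eq {M : Type} [AddCommGroup M] [LieRingModule Sl2 M] (m : M) :
    ⁅Sl2.h, m⁆ = ⁅Sl2.e, ⁅Sl2.f, m⁆⁆ - ⁅Sl2.f, ⁅Sl2.e, m⁆⁆ := by
  rw [← Sl2.lie_e_f, lie_lie]

/-! ### Weight vectors and integrable `sl₂`-modules. -/

section Weights

variable {M N : Type} [AddCommGroup M] [Module ℂ M] [LieRingModule Sl2 M] [LieModule ℂ Sl2 M]
  [AddCommGroup N] [Module ℂ N] [LieRingModule Sl2 N] [LieModule ℂ Sl2 N]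

theorem lie_eq_combination (x : Sl2) (m : M) :
    ⁅x, m⁆ = x.1 0 0 • ⁅Sl2.h, m⁆ + x.1 0 1 • ⁅Sl2.e, m⁆ + x.1 1 0 • ⁅Sl2.f, m⁆ := by
  conv_lhs => rw [Sl2.eq_combination x]
  simp only [add_lie, smul_lie]

/-- A linear map commuting with `e` and `f` is a homomorphism of `sl₂`-modules. -/
def lieModuleHomOfCommute (φ : M →ₗ[ℂ] N) (he : ∀ m, φ ⁅Sl2.e, m⁆ = ⁅Sl2.e, φ m⁆)
    (hf : ∀ m, φ ⁅Sl2.f, m⁆ = ⁅Sl2.f, φ m⁆) : M →ₗ⁅ℂ,Sl2⁆ N where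
  __ := φ
  map_lie' {x m} := by
    change φ ⁅x, m⁆ = ⁅x, φ m⁆
    rw [lie_eq_combination x m, lie_eq_combination x (φ m), lie_h_eq, lie_h_eq]
    simp only [map_add, map_smul, map_sub, he, hf]

variable (M) in
/-- The vectors of `h`-weight `μ`. -/
def weightSpace (μ : ℂ) : Submodule ℂ M := (LieModule.toEnd ℂ Sl2 M Sl2.h).eigenspace μ

theorem mem_weightSpace {μ : ℂ} {m : M} : m ∈ weightSpace M μ ↔ ⁅Sl2.h, m⁆ = μ • m :=
  Module.End.mem_eigenspace_iff

variable (M) in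
theorem iSupIndep_weightSpace : iSupIndep (weightSpace M) :=
  Module.End.eigenspaces_iSupIndep _

theorem lie_e_mem_weightSpace {μ : ℂ} {m : M} (hm : m ∈ weightSpace M μ) :
    ⁅Sl2.e, m⁆ ∈ weightSpace M (μ + 2) := by
  rw [mem_weightSpace] at *
  rw [leibniz_lie, Sl2.lie_h_e, hm, smul_lie, lie_smul, add_smul, add_comm]

theorem lie_f_mem_weightSpace {μ : ℂ} {m : M} (hm : m ∈ weightSpace M μ) :
    ⁅Sl2.f, m⁆ ∈ weightSpace M (μ - 2) := by
  rw [mem_weightSpace] at *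
  rw [leibniz_lie, Sl2.lie_h_f, hm, smul_lie, lie_smul, sub_eq_add_neg, add_smul, add_comm]

variable (M) in
/-- The highest weight vectors of weight `k`, together with `0`. -/
def highestWeightSpace (k : ℂ) : Submodule ℂ M :=
  weightSpace M k ⊓ LinearMap.ker (LieModule.toEnd ℂ Sl2 M Sl2.e)

theorem mem_highestWeightSpace {k : ℂ} {m : M} :
    m ∈ highestWeightSpace M k ↔ ⁅Sl2.h, m⁆ = k • m ∧ ⁅Sl2.e, m⁆ = 0 := by
  rw [highestWeightSpace, Submodule.mem_inf, mem_weightSpace, LinearMap.mem_ker]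
  rfl

variable (M) in
/-- The action of `e`. -/
abbrev actE : Module.End ℂ M := LieModule.toEnd ℂ Sl2 M Sl2.e

variable (M) in
/-- The action of `f`. -/
abbrev actF : Module.End ℂ M := LieModule.toEnd ℂ Sl2 M Sl2.f

theorem actE_pow_mem_weightSpace {μ : ℂ} {m : M} (hm : m ∈ weightSpace M μ) (n : ℕ) :
    (actE M ^ n) m ∈ weightSpace M (μ + 2 * n) := by
  induction n with
  | zero => simpa using hm
  | succ n ih =>
    have hn : μ + 2 * ((n + 1 : ℕ) : ℂ) = μ + 2 * n + 2 := by
      push_cast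
      ring
    rw [pow_succ', Module.End.mul_apply, hn]
    exact lie_e_mem_weightSpace ih

theorem actF_pow_mem_weightSpace {μ : ℂ} {m : M} (hm : m ∈ weightSpace M μ) (n : ℕ) :
    (actF M ^ n) m ∈ weightSpace M (μ - 2 * n) := by
  induction n with
  | zero => simpa using hm
  | succ n ih =>
    have hn : μ - 2 * ((n + 1 : ℕ) : ℂ) = μ - 2 * n - 2 := by
      push_cast
      ring
    rw [pow_succ', Module.End.mul_apply, hn]
    exact lie_f_mem_weightSpace ih

/-- The identity `[e, f^(n+1)] = (n+1) f^n (h - n)` in `U(sl₂)`, evaluated on a weight vector. The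
term with `e m` is kept because the extremal projector applies it to vectors that are not of highest
weight. -/
theorem lie_e_actF_pow {μ : ℂ} {m : M} (hm : m ∈ weightSpace M μ) (n : ℕ) :
    ⁅Sl2.e, (actF M ^ (n + 1)) m⁆ =
      (actF M ^ (n + 1)) ⁅Sl2.e, m⁆ + (((n : ℂ) + 1) * (μ - n)) • (actF M ^ n) m := by
  have key : ∀ m' : M, ⁅Sl2.e, ⁅Sl2.f, m'⁆⁆ = ⁅Sl2.h, m'⁆ + ⁅Sl2.f, ⁅Sl2.e, m'⁆⁆ := fun m' => by
    rw [lie_h_eq, sub_add_cancel]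
  induction n with
  | zero =>
    simp only [zero_add, pow_one, pow_zero, LieModule.toEnd_apply_apply, Module.End.one_apply]
    rw [key, mem_weightSpace.1 hm, add_comm]
    congr 2
    push_cast
    ring
  | succ n ih =>
    rw [pow_succ' _ (n + 1), Module.End.mul_apply, LieModule.toEnd_apply_apply, key, ih,
      mem_weightSpace.1 (actF_pow_mem_weightSpace hm (n + 1)), lie_add, lie_smul,
      Module.End.mul_apply, LieModule.toEnd_apply_apply]
    rw [show ⁅Sl2.f, (actF M ^ n) m⁆ = (actF M ^ (n + 1)) m by
      rw [pow_succ', Module.End.mul_apply, LieModule.toEnd_apply_apply]]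
    rw [add_left_comm, ← add_smul]
    congr 2
    push_cast
    ring

variable (M) in
/-- An `sl₂`-module is integrable when it is spanned by weight vectors and `e` and `f` act locally
nilpotently. -/
structure IsIntegrable : Prop where
  iSup_weightSpace : ⨆ μ, weightSpace M μ = ⊤
  e_nilpotent : ∀ m : M, ∃ n : ℕ, (actE M ^ n) m = 0
  f_nilpotent : ∀ m : M, ∃ n : ℕ, (actF M ^ n) m = 0

theorem map_actE_pow (φ : M →ₗ⁅ℂ,Sl2⁆ N) (n : ℕ) (m : M) :
    φ ((actE M ^ n) m) = (actE N ^ n) (φ m) := by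
  induction n generalizing m with
  | zero => rfl
  | succ n ih => simp only [pow_succ, Module.End.mul_apply, ih, LieModule.toEnd_apply_apply,
      LieModuleHom.map_lie]

theorem map_actF_pow (φ : M →ₗ⁅ℂ,Sl2⁆ N) (n : ℕ) (m : M) :
    φ ((actF M ^ n) m) = (actF N ^ n) (φ m) := by
  induction n generalizing m with
  | zero => rfl
  | succ n ih => simp only [pow_succ, Module.End.mul_apply, ih, LieModule.toEnd_apply_apply,
      LieModuleHom.map_lie]

theorem map_weightSpace_le (φ : M →ₗ⁅ℂ,Sl2⁆ N) (μ : ℂ) :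
    (weightSpace M μ).map (φ : M →ₗ[ℂ] N) ≤ weightSpace N μ := by
  rintro _ ⟨m, hm, rfl⟩
  have hm' : ⁅Sl2.h, m⁆ = μ • m := mem_weightSpace.1 hm
  rw [mem_weightSpace, LieModuleHom.coe_toLinearMap, ← LieModuleHom.map_lie, hm',
    map_smul]

theorem IsIntegrable.of_surjective (hM : IsIntegrable M) (φ : M →ₗ⁅ℂ,Sl2⁆ N)
    (hφ : Function.Surjective φ) : IsIntegrable N where
  iSup_weightSpace := by
    have h : (⊤ : Submodule ℂ M).map (φ : M →ₗ[ℂ] N) = ⊤ := by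
      rw [Submodule.map_top, LinearMap.range_eq_top]
      exact hφ
    rw [eq_top_iff, ← h, ← hM.iSup_weightSpace, Submodule.map_iSup]
    exact iSup_mono fun μ => map_weightSpace_le φ μ
  e_nilpotent q := by
    obtain ⟨m, rfl⟩ := hφ q
    obtain ⟨n, hn⟩ := hM.e_nilpotent m
    exact ⟨n, by rw [← map_actE_pow, hn, map_zero]⟩
  f_nilpotent q := by
    obtain ⟨m, rfl⟩ := hφ q
    obtain ⟨n, hn⟩ := hM.f_nilpotent m
    exact ⟨n, by rw [← map_actF_pow, hn, map_zero]⟩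

/-- The highest weight of a locally finite module is a natural number. -/
theorem eq_natCast_of_highestWeight {μ : ℂ} {m : M} (hm : m ∈ highestWeightSpace M μ)
    (h0 : m ≠ 0) (hf : ∃ n : ℕ, (actF M ^ n) m = 0) : ∃ k : ℕ, μ = k := by
  obtain ⟨n, hn₁, hn₂⟩ := Nat.exists_not_and_succ_of_not_zero_of_exists
    (p := fun n => (actF M ^ n) m = 0) h0 hf
  refine ⟨n, ?_⟩
  -- Here `f^n m ≠ 0 = f^(n+1) m`, so the commutator formula leaves `(n+1)(μ - n) = 0`.
  have := lie_e_actF_pow hm.1 n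
  rw [hn₂, lie_zero, (mem_highestWeightSpace.1 hm).2, map_zero, zero_add, eq_comm,
    smul_eq_zero_iff_left hn₁, mul_eq_zero, sub_eq_zero] at this
  exact this.resolve_left (Nat.cast_add_one_ne_zero n)

/-- The factor `k - k` in the commutator formula makes `e` kill `f^(k+1) m`. If nonzero, this vector
would be of highest weight `-k-2`, which is not a natural number. -/
theorem IsIntegrable.actF_pow_succ (hM : IsIntegrable M) {k : ℕ} {m : M}
    (hm : m ∈ highestWeightSpace M k) : (actF M ^ (k + 1)) m = 0 := by
  by_contra h0
  have h1 : (actF M ^ (k + 1)) m ∈ highestWeightSpace M ((k : ℂ) - 2 * ((k + 1 : ℕ) : ℂ)) := by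
    refine ⟨actF_pow_mem_weightSpace hm.1 (k + 1), ?_⟩
    change ⁅Sl2.e, _⁆ = (0 : M)
    rw [lie_e_actF_pow hm.1, (mem_highestWeightSpace.1 hm).2]
    simp
  obtain ⟨j, hj⟩ := eq_natCast_of_highestWeight h1 h0 (hM.f_nilpotent _)
  have h2 : (j : ℂ) + k + 2 = 0 := by
    rw [← hj]
    push_cast
    ring
  exact absurd h2 (by exact_mod_cast Nat.succ_ne_zero (j + k + 1))

/-- Induction on the number of weights involved: `h - ν` preserves `W` and removes the component of
weight `ν`. Either it kills `m`, which is then a weight vector, or it gives a nonzero vector of `W`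
with fewer weights. -/
theorem exists_weightVector_mem (W : LieSubmodule ℂ Sl2 M) (S : Finset ℂ) :
    ∀ m ∈ W, m ≠ 0 → m ∈ ⨆ μ ∈ S, weightSpace M μ →
      ∃ μ, ∃ w ∈ W, w ≠ 0 ∧ w ∈ weightSpace M μ := by
  classical
  induction S using Finset.induction_on with
  | empty =>
    intro m _ h0 hm
    simp at hm
    exact absurd hm h0
  | insert ν S _ ih =>
    intro m hmW h0 hm
    rw [Finset.iSup_insert] at hm
    obtain ⟨a, ha, b, hb, rfl⟩ := Submodule.mem_sup.1 hm
    by_cases h1 : ⁅Sl2.h, a + b⁆ - ν • (a + b) = 0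
    · exact ⟨ν, a + b, hmW, h0, mem_weightSpace.2 (sub_eq_zero.1 h1)⟩
    · refine ih _ (sub_mem (W.lie_mem hmW) (W.smul_mem _ hmW)) h1 ?_
      rw [lie_add, mem_weightSpace.1 ha, smul_add, add_sub_add_left_eq_sub]
      refine sub_mem ?_ (Submodule.smul_mem _ _ hb)
      have : (⨆ μ ∈ S, weightSpace M μ).map (LieModule.toEnd ℂ Sl2 M Sl2.h) ≤
          ⨆ μ ∈ S, weightSpace M μ := by
        simp only [Submodule.map_iSup]
        refine iSup₂_mono fun μ _ => ?_
        rintro _ ⟨w, hw, rfl⟩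
        rw [LieModule.toEnd_apply_apply, mem_weightSpace.1 hw]
        exact Submodule.smul_mem _ _ hw
      exact this ⟨b, hb, rfl⟩

/-- Apply `e` to a weight vector of the submodule and keep the last nonzero power. -/
theorem IsIntegrable.exists_highestWeight_mem (hM : IsIntegrable M) (W : LieSubmodule ℂ Sl2 M)
    (hW : W ≠ ⊥) : ∃ k : ℕ, ∃ m ∈ W, m ≠ 0 ∧ m ∈ highestWeightSpace M k := by
  obtain ⟨m, hm, h0⟩ : ∃ m ∈ W, m ≠ 0 := by
    by_contra! hc
    exact hW ((LieSubmodule.eq_bot_iff W).2 hc)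
  have hm' : m ∈ ⨆ μ, weightSpace M μ := hM.iSup_weightSpace ▸ Submodule.mem_top
  obtain ⟨S, hS⟩ := Submodule.mem_iSup_iff_exists_finset.1 hm'
  obtain ⟨μ, w, hw, hw0, hwμ⟩ := exists_weightVector_mem W S m hm h0 hS
  obtain ⟨n, hn₁, hn₂⟩ := Nat.exists_not_and_succ_of_not_zero_of_exists
    (p := fun n => (actE M ^ n) w = 0) hw0 (hM.e_nilpotent w)
  have hmem : (actE M ^ n) w ∈ highestWeightSpace M (μ + 2 * n) := by
    refine ⟨actE_pow_mem_weightSpace hwμ n, ?_⟩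
    rwa [pow_succ', Module.End.mul_apply] at hn₂
  have hWn : ∀ j : ℕ, (actE M ^ j) w ∈ W := fun j => by
    induction j with
    | zero => exact hw
    | succ j ih =>
      rw [pow_succ', Module.End.mul_apply]
      exact W.lie_mem ih
  obtain ⟨k, hk⟩ := eq_natCast_of_highestWeight hmem hn₁ (hM.f_nilpotent _)
  exact ⟨k, _, hWn n, hn₁, hk ▸ hmem⟩

/-! ### Lifting highest weight vectors -/

/-- The component of weight `μ` of any preimage works: the image of the remaining part has weight
`μ` and also lies in the sum of the other weight spaces, so it vanishes. -/
theorem IsIntegrable.exists_weight_lift (hM : IsIntegrable M) (φ : M →ₗ⁅ℂ,Sl2⁆ N)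
    (hφ : Function.Surjective φ) {μ : ℂ} {q : N} (hq : q ∈ weightSpace N μ) :
    ∃ m ∈ weightSpace M μ, φ m = q := by
  obtain ⟨m, rfl⟩ := hφ q
  have hm : m ∈ weightSpace M μ ⊔ ⨆ (ν) (_ : ν ≠ μ), weightSpace M ν := by
    rw [← iSup_split_single, hM.iSup_weightSpace]
    trivial
  obtain ⟨a, ha, b, hb, rfl⟩ := Submodule.mem_sup.1 hm
  refine ⟨a, ha, ?_⟩
  have ha' : φ a ∈ weightSpace N μ := map_weightSpace_le φ μ ⟨a, ha, rfl⟩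
  have hb₁ : φ b ∈ weightSpace N μ := by
    have := sub_mem hq ha'
    rwa [map_add, add_sub_cancel_left] at this
  have hb₂ : φ b ∈ ⨆ (ν) (_ : ν ≠ μ), weightSpace N ν := by
    have : (⨆ (ν) (_ : ν ≠ μ), weightSpace M ν).map (φ : M →ₗ[ℂ] N) ≤
        ⨆ (ν) (_ : ν ≠ μ), weightSpace N ν := by
      simp only [Submodule.map_iSup]
      exact iSup₂_mono fun ν _ => map_weightSpace_le φ ν
    exact this ⟨b, hb, rfl⟩
  have hb₀ : φ b = 0 := (Submodule.disjoint_def.1 (iSupIndep_weightSpace N μ)) _ hb₁ hb₂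
  rw [map_add, hb₀, add_zero]

/-- The coefficients of the extremal projector on vectors of weight `k`. -/
def extremalCoeff (k : ℕ) : ℕ → ℂ
  | 0 => 1
  | j + 1 => -extremalCoeff k j / (((j : ℂ) + 1) * ((k : ℂ) + j + 2))

variable (M) in
/-- A partial sum of the extremal projector on vectors of weight `k`. -/
def extremalSum (k n : ℕ) : Module.End ℂ M :=
  ∑ j ∈ Finset.range (n + 1), extremalCoeff k j • (actF M ^ j * actE M ^ j)

/-- The sum telescopes. By the commutator formula `e f^(n+1) e^(n+1) m` contributes `(n+1)(k+n+2)
f^n e^(n+1) m`, and the recursion for the coefficients is chosen to cancel this against the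
remainder of the preceding partial sum. The denominators do not vanish because `k` is a natural
number. -/
theorem lie_e_extremalSum {k : ℕ} {m : M} (hm : m ∈ weightSpace M k) (n : ℕ) :
    ⁅Sl2.e, extremalSum M k n m⁆ = extremalCoeff k n • (actF M ^ n) ((actE M ^ (n + 1)) m) := by
  induction n with
  | zero => simp [extremalSum, extremalCoeff]
  | succ n ih =>
    have h1 : ((n : ℂ) + 1) ≠ 0 := Nat.cast_add_one_ne_zero n
    have h2 : ((k : ℂ) + n + 2) ≠ 0 := by exact_mod_cast Nat.succ_ne_zero (k + n + 1)
    rw [extremalSum, Finset.sum_range_succ, ← extremalSum, LinearMap.add_apply, lie_add, ih,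
      LinearMap.smul_apply, Module.End.mul_apply, lie_smul,
      lie_e_actF_pow (actE_pow_mem_weightSpace hm (n + 1)), smul_add, smul_smul,
      pow_succ' (actE M) (n + 1), Module.End.mul_apply, LieModule.toEnd_apply_apply, add_left_comm,
      ← add_smul]
    have h3 : extremalCoeff k n + extremalCoeff k (n + 1) *
        (((n : ℂ) + 1) * ((k : ℂ) + 2 * ((n + 1 : ℕ) : ℂ) - n)) = 0 := by
      rw [extremalCoeff]
      push_cast
      field_simp
      ring
    rw [h3, zero_smul, add_zero]

/-- Complete reducibility rests on this. Lift to a weight vector and apply the extremal projector: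
the result is killed by `e`, and its image is unchanged since every term other than the first
contains a positive power of `e`, which kills `q`. -/
theorem IsIntegrable.exists_highestWeight_lift (hM : IsIntegrable M) (φ : M →ₗ⁅ℂ,Sl2⁆ N)
    (hφ : Function.Surjective φ) {k : ℕ} {q : N} (hq : q ∈ highestWeightSpace N k) :
    ∃ m ∈ highestWeightSpace M k, φ m = q := by
  obtain ⟨m, hm, rfl⟩ := hM.exists_weight_lift φ hφ hq.1
  obtain ⟨n, hn⟩ := hM.e_nilpotent m
  refine ⟨extremalSum M k n m, ⟨?_, ?_⟩, ?_⟩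
  · rw [extremalSum, LinearMap.sum_apply]
    refine sum_mem fun j _ => Submodule.smul_mem _ _ ?_
    have := actF_pow_mem_weightSpace (actE_pow_mem_weightSpace hm j) j
    rwa [add_sub_cancel_right] at this
  · change ⁅Sl2.e, _⁆ = (0 : M)
    rw [lie_e_extremalSum hm, pow_succ', Module.End.mul_apply, hn, map_zero, map_zero, smul_zero]
  · rw [extremalSum, LinearMap.sum_apply, map_sum, Finset.sum_range_succ']
    rw [Finset.sum_eq_zero fun j _ => ?_, zero_add]
    · simp [extremalCoeff]
    · have h0 : (actE N ^ (j + 1)) (φ m) = 0 := by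
        rw [pow_succ, Module.End.mul_apply, LieModule.toEnd_apply_apply,
          (mem_highestWeightSpace.1 hq).2, map_zero]
      rw [LinearMap.smul_apply, Module.End.mul_apply, map_smul, map_actF_pow,
        map_actE_pow, h0, map_zero, smul_zero]

end Weights

/-! ### The modules `L(n)` -/

namespace Irrep

variable {n : ℕ}

theorem coord_of_le (w : Irrep n) {j : ℕ} (hj : n + 1 ≤ j) : coord w j = 0 :=
  dif_neg (not_lt.2 hj)

theorem ext_coord {v w : Irrep n} (hvw : ∀ j ≤ n, coord v j = coord w j) : v = w := by
  funext ⟨j, hj⟩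
  simpa [coord, hj] using hvw j (Nat.lt_succ_iff.1 hj)

theorem coord_zero (j : ℕ) : coord (0 : Irrep n) j = 0 := by
  have := coord_smul n 0 (0 : Irrep n) j
  rwa [zero_smul, zero_mul] at this

theorem coord_lie_e (w : Irrep n) (j : ℕ) :
    coord ⁅Sl2.e, w⁆ j = ((n : ℂ) - j) * coord w (j + 1) := by
  rcases Nat.lt_or_ge j (n + 1) with hj | hj
  · change coord (act Sl2.e w) j = _
    rw [coord_act n _ _ _ hj]
    simp [Sl2.e]
  · rw [coord_of_le _ hj, coord_of_le _ (hj.trans (Nat.le_succ j)), mul_zero]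

theorem coord_lie_f_zero (w : Irrep n) : coord ⁅Sl2.f, w⁆ 0 = 0 := by
  change coord (act Sl2.f w) 0 = _
  rw [coord_act n _ _ _ (Nat.succ_pos n)]
  simp [Sl2.f]

theorem coord_lie_f_succ (w : Irrep n) {j : ℕ} (hj : j < n) :
    coord ⁅Sl2.f, w⁆ (j + 1) = ((j : ℂ) + 1) * coord w j := by
  change coord (act Sl2.f w) (j + 1) = _
  rw [coord_act n _ _ _ (Nat.succ_lt_succ hj)]
  simp [Sl2.f]

theorem coord_lie_h (w : Irrep n) {j : ℕ} (hj : j < n + 1) :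
    coord ⁅Sl2.h, w⁆ j = ((n : ℂ) - 2 * j) * coord w j := by
  change coord (act Sl2.h w) j = _
  rw [coord_act n _ _ _ hj]
  simp [Sl2.h]

variable (n) in
/-- The basis vector `v_{n - 2j}` of `L(n)`, read as zero for `j > n`. -/
def vec (j : ℕ) : Irrep n := fun i => if i.1 = j then 1 else 0

theorem coord_vec {i : ℕ} (hi : i ≤ n) (j : ℕ) : coord (vec n j) i = if i = j then 1 else 0 := by
  rw [coord, dif_pos (Nat.lt_succ_iff.2 hi)]
  rfl

theorem lie_f_vec (j : ℕ) : ⁅Sl2.f, vec n j⁆ = ((j : ℂ) + 1) • vec n (j + 1) := by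
  refine ext_coord fun i hi => ?_
  rw [coord_smul, coord_vec hi]
  rcases i with _ | i
  · rw [coord_lie_f_zero]
    simp
  · rw [coord_lie_f_succ _ (Nat.lt_of_succ_le hi), coord_vec (Nat.le_of_succ_le hi)]
    by_cases hij : i = j
    · simp [hij]
    · simp [hij]

theorem eq_smul_vec_zero (w : Irrep n) (hw : ∀ j, 0 < j → coord w j = 0) :
    w = coord w 0 • vec n 0 := by
  refine ext_coord fun i hi => ?_
  rw [coord_smul, coord_vec hi]
  rcases i with _ | i
  · simp
  · simp [hw (i + 1) (Nat.succ_pos i)]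

theorem mem_of_vec_zero_mem (K : LieSubmodule ℂ Sl2 (Irrep n)) (h0 : vec n 0 ∈ K) : K = ⊤ := by
  have hvec : ∀ j ≤ n, vec n j ∈ K := fun j => by
    induction j with
    | zero => exact fun _ => h0
    | succ j ih =>
      intro hj
      have h1 := K.smul_mem ((j : ℂ) + 1)⁻¹ (K.lie_mem (x := Sl2.f) (ih (Nat.le_of_succ_le hj)))
      rwa [lie_f_vec, smul_smul, inv_mul_cancel₀ (Nat.cast_add_one_ne_zero j), one_smul] at h1
  rw [eq_top_iff]
  intro w _
  have hw : w = ∑ j : Fin (n + 1), w j • vec n j := by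
    funext i
    have : ∀ g : Fin (n + 1) → Irrep n, (∑ j, g j) i = ∑ j, g j i := fun g =>
      Finset.sum_apply i _ _
    rw [this, Finset.sum_eq_single i]
    · change _ = w i * (if i.1 = i.1 then 1 else 0)
      simp
    · intro j _ hj
      change w j * (if i.1 = j.1 then 1 else 0) = 0
      rw [if_neg fun hij => hj (Fin.ext hij.symm), mul_zero]
    · simp
  rw [hw]
  exact sum_mem fun j _ => K.smul_mem _ (hvec j (Nat.lt_succ_iff.1 j.2))

/-- Each application of `e` moves the last nonzero coordinate down by one index, with the nonzero
factor `n - J`, until only a multiple of the highest weight vector is left. -/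
theorem vec_zero_mem_of_mem (K : LieSubmodule ℂ Sl2 (Irrep n)) (J : ℕ) :
    J ≤ n → ∀ w ∈ K, coord w J ≠ 0 → (∀ j, J < j → coord w j = 0) → vec n 0 ∈ K := by
  induction J with
  | zero =>
    intro _ w hw h0 hz
    have h1 := K.smul_mem (coord w 0)⁻¹ hw
    rwa [eq_smul_vec_zero w hz, smul_smul, coord_smul, coord_vec (Nat.zero_le n), if_pos rfl,
      mul_one, inv_mul_cancel₀ h0, one_smul] at h1
  | succ J ih =>
    intro hJ w hw h0 hz
    refine ih (Nat.le_of_succ_le hJ) _ (K.lie_mem (x := Sl2.e) hw) ?_ fun j hj => ?_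
    · rw [coord_lie_e]
      refine mul_ne_zero ?_ h0
      rw [sub_ne_zero]
      exact_mod_cast (Nat.lt_of_succ_le hJ).ne'
    · rw [coord_lie_e, hz _ (Nat.succ_lt_succ hj), mul_zero]

theorem eq_top_of_ne_bot (K : LieSubmodule ℂ Sl2 (Irrep n)) (hK : K ≠ ⊥) : K = ⊤ := by
  obtain ⟨w, hw, h0⟩ : ∃ w ∈ K, w ≠ 0 := by
    by_contra! hc
    exact hK ((LieSubmodule.eq_bot_iff K).2 hc)
  obtain ⟨J, hJ, hJ'⟩ : ∃ J ≤ n, coord w J ≠ 0 := by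
    by_contra! hc
    exact h0 (ext_coord fun j hj => (hc j hj).trans (coord_zero j).symm)
  have hne : ((Finset.range (n + 1)).filter fun j => coord w j ≠ 0).Nonempty :=
    ⟨J, by simp [Nat.lt_succ_iff.2 hJ, hJ']⟩
  set J' := Finset.max' _ hne with hJdef
  have hmem := Finset.max'_mem _ hne
  rw [← hJdef, Finset.mem_filter, Finset.mem_range] at hmem
  refine mem_of_vec_zero_mem K (vec_zero_mem_of_mem K J' (Nat.lt_succ_iff.1 hmem.1) w hw hmem.2
    fun j hj => ?_)
  by_contra hc
  have hjn : j < n + 1 := by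
    by_contra hjn
    exact hc (coord_of_le w (not_lt.1 hjn))
  exact absurd (Finset.le_max' _ j (by simp [hjn, hc])) (not_le.2 hj)

theorem vec_zero_ne_zero : vec n 0 ≠ 0 := by
  intro h0
  have := congrArg (fun w => coord w 0) h0
  simp only [coord_vec (Nat.zero_le n), coord_zero] at this
  simp at this

theorem vec_zero_mem_highestWeightSpace : vec n 0 ∈ highestWeightSpace (Irrep n) n := by
  rw [mem_highestWeightSpace]
  constructor
  · refine ext_coord fun j hj => ?_
    rw [coord_lie_h _ (Nat.lt_succ_iff.2 hj), coord_smul, coord_vec hj]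
    by_cases hj0 : j = 0
    · simp [hj0]
    · simp [hj0]
  · refine ext_coord fun j hj => ?_
    rw [coord_lie_e, coord_zero]
    rcases hj.eq_or_lt with rfl | hj
    · simp
    · rw [coord_vec hj, if_neg (Nat.succ_ne_zero j), mul_zero]

theorem eq_smul_vec_of_lie_e_eq_zero {w : Irrep n} (hw : ⁅Sl2.e, w⁆ = 0) :
    w = coord w 0 • vec n 0 := by
  refine eq_smul_vec_zero w fun j hj => ?_
  obtain ⟨i, rfl⟩ := Nat.exists_eq_succ_of_ne_zero hj.ne'
  rcases Nat.lt_or_ge i n with hi | hi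
  · have h1 := coord_lie_e w i
    rw [hw, coord_zero, zero_eq_mul, sub_eq_zero] at h1
    exact h1.resolve_left (by exact_mod_cast hi.ne')
  · exact coord_of_le w (Nat.succ_le_succ hi)

instance : Module.Finite ℂ (Irrep n) := inferInstanceAs (Module.Finite ℂ (Fin (n + 1) → ℂ))

end Irrep

/-! ### Integrable modules as direct sums of copies of the `L(k)`. -/

section Decomposition

variable {M : Type} [AddCommGroup M] [Module ℂ M] [LieRingModule Sl2 M] [LieModule ℂ Sl2 M]

/-- The linear map `L(k) → M` with `v_{k - 2j} ↦ f ^ j m / j!`. -/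
def fromIrrepLinear (k : ℕ) (m : M) : Irrep k →ₗ[ℂ] M where
  toFun w := ∑ j ∈ Finset.range (k + 1),
    (Irrep.coord w j / (j.factorial : ℂ)) • (actF M ^ j) m
  map_add' v w := by
    rw [← Finset.sum_add_distrib]
    exact Finset.sum_congr rfl fun j _ => by rw [Irrep.coord_add, add_div, add_smul]
  map_smul' c w := by
    rw [RingHom.id_apply, Finset.smul_sum]
    exact Finset.sum_congr rfl fun j _ => by rw [Irrep.coord_smul, mul_div_assoc, mul_smul]

theorem fromIrrepLinear_apply (k : ℕ) (m : M) (w : Irrep k) :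
    fromIrrepLinear k m w = ∑ j ∈ Finset.range (k + 1),
      (Irrep.coord w j / (j.factorial : ℂ)) • (actF M ^ j) m := rfl

/-- The division by `j!` matches the two normalisations: `e f^(j+1) m = (j+1)(k-j) f^j m`, and
`(j+1)/(j+1)! = 1/j!` leaves the factor `k - j` of `L(k)`. -/
theorem fromIrrepLinear_lie_e {k : ℕ} {m : M} (hm : m ∈ highestWeightSpace M k) (w : Irrep k) :
    fromIrrepLinear k m ⁅Sl2.e, w⁆ = ⁅Sl2.e, fromIrrepLinear k m w⁆ := by
  have hm' := mem_highestWeightSpace.1 hm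
  rw [fromIrrepLinear_apply, fromIrrepLinear_apply, lie_sum, Finset.sum_range_succ,
    Finset.sum_range_succ', Irrep.coord_lie_e, sub_self, zero_mul, zero_div, zero_smul, add_zero,
    pow_zero, Module.End.one_apply, lie_smul, hm'.2, smul_zero, add_zero]
  refine Finset.sum_congr rfl fun j _ => ?_
  rw [lie_smul, lie_e_actF_pow hm.1, hm'.2, map_zero, zero_add, smul_smul, Irrep.coord_lie_e]
  congr 1
  have h1 : ((j : ℂ) + 1) ≠ 0 := Nat.cast_add_one_ne_zero j
  have h2 : (j.factorial : ℂ) ≠ 0 := Nat.cast_ne_zero.2 j.factorial_ne_zero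
  rw [Nat.factorial_succ]
  push_cast
  field_simp

theorem fromIrrepLinear_lie_f {k : ℕ} {m : M} (hm : (actF M ^ (k + 1)) m = 0) (w : Irrep k) :
    fromIrrepLinear k m ⁅Sl2.f, w⁆ = ⁅Sl2.f, fromIrrepLinear k m w⁆ := by
  have hF : ∀ j, ⁅Sl2.f, (actF M ^ j) m⁆ = (actF M ^ (j + 1)) m := fun j => by
    rw [pow_succ', Module.End.mul_apply, LieModule.toEnd_apply_apply]
  rw [fromIrrepLinear_apply, fromIrrepLinear_apply, lie_sum, Finset.sum_range_succ',
    Finset.sum_range_succ, Irrep.coord_lie_f_zero, zero_div, zero_smul, add_zero, lie_smul, hF, hm,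
    smul_zero, add_zero]
  refine Finset.sum_congr rfl fun j hj => ?_
  rw [lie_smul, hF, Irrep.coord_lie_f_succ _ (Finset.mem_range.1 hj)]
  congr 1
  have h1 : ((j : ℂ) + 1) ≠ 0 := Nat.cast_add_one_ne_zero j
  have h2 : (j.factorial : ℂ) ≠ 0 := Nat.cast_ne_zero.2 j.factorial_ne_zero
  rw [Nat.factorial_succ]
  push_cast
  field_simp

/-- The homomorphism `L(k) → M` given by a highest weight vector of weight `k`. -/
def fromIrrep (hM : IsIntegrable M) {k : ℕ} {m : M} (hm : m ∈ highestWeightSpace M k) :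
    Irrep k →ₗ⁅ℂ,Sl2⁆ M :=
  lieModuleHomOfCommute (fromIrrepLinear k m) (fromIrrepLinear_lie_e hm)
    (fromIrrepLinear_lie_f (hM.actF_pow_succ hm))

theorem fromIrrep_vec_zero (hM : IsIntegrable M) {k : ℕ} {m : M}
    (hm : m ∈ highestWeightSpace M k) : fromIrrep hM hm (Irrep.vec k 0) = m := by
  change fromIrrepLinear k m (Irrep.vec k 0) = m
  rw [fromIrrepLinear_apply, Finset.sum_range_succ', Finset.sum_eq_zero fun j hj => ?_]
  · simp [Irrep.coord_vec]
  · rw [Irrep.coord_vec (Finset.mem_range.1 hj), if_neg (Nat.succ_ne_zero j), zero_div, zero_smul]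

theorem fromIrrep_mem (hM : IsIntegrable M) {k : ℕ} {m : M} (hm : m ∈ highestWeightSpace M k)
    {W : LieSubmodule ℂ Sl2 M} (hW : m ∈ W) (w : Irrep k) : fromIrrep hM hm w ∈ W := by
  have hF : ∀ j : ℕ, (actF M ^ j) m ∈ W := fun j => by
    induction j with
    | zero => exact hW
    | succ j ih =>
      rw [pow_succ', Module.End.mul_apply]
      exact W.lie_mem ih
  change fromIrrepLinear k m w ∈ W
  rw [fromIrrepLinear_apply]
  exact sum_mem fun j _ => W.smul_mem _ (hF j)

theorem fromIrrep_injective (hM : IsIntegrable M) {k : ℕ} {m : M}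
    (hm : m ∈ highestWeightSpace M k) (h0 : m ≠ 0) : Function.Injective (fromIrrep hM hm) := by
  rw [← LieModuleHom.ker_eq_bot]
  by_contra hK
  have h1 : Irrep.vec k 0 ∈ (fromIrrep hM hm).ker := by
    rw [Irrep.eq_top_of_ne_bot _ hK]
    trivial
  rw [LieModuleHom.mem_ker, fromIrrep_vec_zero] at h1
  exact h0 h1

theorem isAtom_range_fromIrrep (hM : IsIntegrable M) {k : ℕ} {m : M}
    (hm : m ∈ highestWeightSpace M k) (h0 : m ≠ 0) : IsAtom (fromIrrep hM hm).range := by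
  have hmem : m ∈ (fromIrrep hM hm).range :=
    (LieModuleHom.mem_range _ _).2 ⟨_, fromIrrep_vec_zero hM hm⟩
  refine ⟨fun hb => h0 ?_, fun K hK => ?_⟩
  · rw [hb] at hmem
    simpa using hmem
  · by_contra hK0
    obtain ⟨w, hw, hw0⟩ : ∃ w ∈ K, w ≠ 0 := by
      by_contra! hc
      exact hK0 ((LieSubmodule.eq_bot_iff K).2 hc)
    obtain ⟨u, rfl⟩ := (LieModuleHom.mem_range _ _).1 (hK.le hw)
    have htop : K.comap (fromIrrep hM hm) = ⊤ := by
      refine Irrep.eq_top_of_ne_bot _ fun hb => hw0 ?_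
      have hu : u ∈ K.comap (fromIrrep hM hm) := hw
      rw [hb, LieSubmodule.mem_bot] at hu
      rw [hu, map_zero]
    refine hK.not_ge fun x hx => ?_
    obtain ⟨y, rfl⟩ := (LieModuleHom.mem_range _ _).1 hx
    have hy : y ∈ K.comap (fromIrrep hM hm) := htop ▸ LieSubmodule.mem_top y
    exact hy

theorem isIrreducible_of_isAtom {W : LieSubmodule ℂ Sl2 M} (hW : IsAtom W) :
    LieModule.IsIrreducible ℂ Sl2 W := by
  have : Nontrivial W := (LieSubmodule.nontrivial_iff_ne_bot ℂ Sl2 M).2 hW.1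
  refine LieModule.IsIrreducible.mk fun K hK => ?_
  have h1 : K.map W.incl ≤ W := by
    rintro _ ⟨x, _, rfl⟩
    exact x.2
  have h2 : K.map W.incl ≠ ⊥ := by
    intro hb
    refine hK ((LieSubmodule.eq_bot_iff K).2 fun x hx => ?_)
    have : W.incl x ∈ K.map W.incl := LieSubmodule.mem_map_of_mem hx
    rw [hb, LieSubmodule.mem_bot] at this
    exact Subtype.ext this
  have h3 : K.map W.incl = W := by
    by_contra hne
    exact h2 (hW.2 _ (lt_of_le_of_ne h1 hne))
  rw [eq_top_iff]
  intro x _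
  have hx : (x : M) ∈ K.map W.incl := h3.symm ▸ x.2
  obtain ⟨y, hy, hyx⟩ := (LieSubmodule.mem_map _).1 hx
  have : y = x := Subtype.ext hyx
  exact this ▸ hy

/-- A nonzero submodule of an integrable module which is irreducible is generated by any of its
highest weight vectors. -/
theorem range_fromIrrep_eq (hM : IsIntegrable M) {W : LieSubmodule ℂ Sl2 M}
    (hW : LieModule.IsIrreducible ℂ Sl2 W) {k : ℕ} {m : M} (hm : m ∈ highestWeightSpace M k)
    (h0 : m ≠ 0) (hmW : m ∈ W) : (fromIrrep hM hm).range = W := by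
  have hle : (fromIrrep hM hm).range ≤ W := by
    intro x hx
    obtain ⟨w, rfl⟩ := (LieModuleHom.mem_range _ _).1 hx
    exact fromIrrep_mem hM hm hmW w
  refine le_antisymm hle fun x hx => ?_
  have hmem : m ∈ (fromIrrep hM hm).range :=
    (LieModuleHom.mem_range _ _).2 ⟨_, fromIrrep_vec_zero hM hm⟩
  have htop : (fromIrrep hM hm).range.comap W.incl = ⊤ := by
    refine (hW.eq_bot_or_eq_top _).resolve_left fun hb => h0 ?_
    have : (⟨m, hmW⟩ : W) ∈ (fromIrrep hM hm).range.comap W.incl := hmem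
    rw [hb, LieSubmodule.mem_bot] at this
    exact congrArg Subtype.val this
  have : (⟨x, hx⟩ : W) ∈ (fromIrrep hM hm).range.comap W.incl := htop ▸ LieSubmodule.mem_top _
  exact this

theorem nonempty_equiv_irrep (hM : IsIntegrable M) {W : LieSubmodule ℂ Sl2 M}
    (hW : LieModule.IsIrreducible ℂ Sl2 W) {k : ℕ} {m : M} (hm : m ∈ highestWeightSpace M k)
    (h0 : m ≠ 0) (hmW : m ∈ W) : Nonempty (W ≃ₗ⁅ℂ,Sl2⁆ Irrep k) := by
  let φ : Irrep k →ₗ⁅ℂ,Sl2⁆ W :=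
    { toFun := fun w => ⟨fromIrrep hM hm w, fromIrrep_mem hM hm hmW w⟩
      map_add' := fun v w => Subtype.ext (map_add _ v w)
      map_smul' := fun c w => Subtype.ext (map_smul _ c w)
      map_lie' := fun {x w} => Subtype.ext (LieModuleHom.map_lie _ x w) }
  have hφ : Function.Bijective φ := by
    refine ⟨fun v w hvw => fromIrrep_injective hM hm h0 (congrArg Subtype.val hvw), ?_⟩
    rintro ⟨x, hx⟩
    rw [← range_fromIrrep_eq hM hW hm h0 hmW] at hx
    obtain ⟨w, hw⟩ := (LieModuleHom.mem_range _ _).1 hx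
    exact ⟨w, Subtype.ext hw⟩
  let ε := LinearEquiv.ofBijective (φ : Irrep k →ₗ[ℂ] W) hφ
  let ψ : Irrep k ≃ₗ⁅ℂ,Sl2⁆ W :=
    { φ with
      invFun := ε.symm
      left_inv := ε.left_inv
      right_inv := ε.right_inv }
  exact ⟨ψ.symm⟩

theorem mem_span_of_highestWeight (hM : IsIntegrable M) {W : LieSubmodule ℂ Sl2 M}
    (hW : LieModule.IsIrreducible ℂ Sl2 W) {k : ℕ} {m : M} (hm : m ∈ highestWeightSpace M k)
    (h0 : m ≠ 0) (hmW : m ∈ W) {m' : M} (he : ⁅Sl2.e, m'⁆ = 0) (hm'W : m' ∈ W) :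
    m' ∈ Submodule.span ℂ {m} := by
  rw [← range_fromIrrep_eq hM hW hm h0 hmW] at hm'W
  obtain ⟨w, rfl⟩ := (LieModuleHom.mem_range _ _).1 hm'W
  have hw : ⁅Sl2.e, w⁆ = 0 := by
    apply fromIrrep_injective hM hm h0
    rw [LieModuleHom.map_lie, he, map_zero]
  rw [Irrep.eq_smul_vec_of_lie_e_eq_zero hw, map_smul, fromIrrep_vec_zero]
  exact Submodule.smul_mem _ _ (Submodule.mem_span_singleton_self m)

/-- An integrable `sl₂`-module is the sum of its minimal submodules. -/
theorem IsIntegrable.sSup_atoms (hM : IsIntegrable M) :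
    sSup {W : LieSubmodule ℂ Sl2 M | IsAtom W} = ⊤ := by
  set S := sSup {W : LieSubmodule ℂ Sl2 M | IsAtom W} with hS
  -- Otherwise the quotient by the sum of the atoms is integrable and nonzero, hence has a highest
  -- weight vector. A highest weight lift of it generates an atom outside that sum.
  by_contra hne
  have hsurj : Function.Surjective (LieSubmodule.Quotient.mk' S) :=
    LieSubmodule.Quotient.surjective_mk' S
  have hQ := hM.of_surjective (LieSubmodule.Quotient.mk' S) hsurj
  have htop : (⊤ : LieSubmodule ℂ Sl2 (M ⧸ S)) ≠ ⊥ := by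
    intro htb
    refine hne (eq_top_iff.2 fun m _ => ?_)
    have : LieSubmodule.Quotient.mk' S m ∈ (⊥ : LieSubmodule ℂ Sl2 (M ⧸ S)) :=
      htb ▸ LieSubmodule.mem_top _
    rw [LieSubmodule.mem_bot] at this
    exact (LieSubmodule.Quotient.mk_eq_zero S).1 this
  obtain ⟨k, q, -, hq0, hq⟩ := hQ.exists_highestWeight_mem ⊤ htop
  obtain ⟨m, hm, rfl⟩ := hM.exists_highestWeight_lift _ hsurj hq
  have h0 : m ≠ 0 := by
    rintro rfl
    exact hq0 (map_zero _)
  have hle : (fromIrrep hM hm).range ≤ S := le_sSup (isAtom_range_fromIrrep hM hm h0)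
  refine hq0 ((LieSubmodule.Quotient.mk_eq_zero S).2 (hle ?_))
  exact (LieModuleHom.mem_range _ _).2 ⟨_, fromIrrep_vec_zero hM hm⟩

theorem finite_of_isIrreducible (hM : IsIntegrable M) {W : LieSubmodule ℂ Sl2 M}
    (hW : LieModule.IsIrreducible ℂ Sl2 W) :
    Module.Finite ℂ W ∧ ∃ k : ℕ, Nonempty (W ≃ₗ⁅ℂ,Sl2⁆ Irrep k) := by
  have hb : W ≠ ⊥ := by
    rw [← LieSubmodule.nontrivial_iff_ne_bot ℂ Sl2 M]
    exact LieModule.nontrivial_of_isIrreducible ℂ Sl2 W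
  obtain ⟨k, m, hmW, h0, hm⟩ := hM.exists_highestWeight_mem W hb
  obtain ⟨ε⟩ := nonempty_equiv_irrep hM hW hm h0 hmW
  exact ⟨Module.Finite.equiv ε.toLinearEquiv.symm, k, ⟨ε⟩⟩

/-- A lattice-theoretic consequence of `IsIntegrable.sSup_atoms`: when the atoms span, some
independent family of atoms already spans. -/
theorem IsIntegrable.exists_decomposition (hM : IsIntegrable M) :
    ∃ s : Set (LieSubmodule ℂ Sl2 M), IsSimpleDecomposition s := by
  obtain ⟨s, hind, htop, hat⟩ := exists_sSupIndep_of_sSup_atoms_eq_top hM.sSup_atoms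
  exact ⟨s, fun N hN => isIrreducible_of_isAtom (hat hN),
    fun N hN => (finite_of_isIrreducible hM (isIrreducible_of_isAtom (hat hN))).1, hind, htop⟩

theorem exists_highestWeight_of_equiv {W : LieSubmodule ℂ Sl2 M} {k : ℕ}
    (ε : W ≃ₗ⁅ℂ,Sl2⁆ Irrep k) : ∃ m ∈ W, m ≠ 0 ∧ m ∈ highestWeightSpace M k := by
  have h1 := mem_highestWeightSpace.1 (Irrep.vec_zero_mem_highestWeightSpace (n := k))
  refine ⟨ε.symm (Irrep.vec k 0), (ε.symm _).2, fun h0 => ?_, ?_⟩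
  · have h2 : ε.symm (Irrep.vec k 0) = 0 := Subtype.ext h0
    have h3 := congrArg ε h2
    rw [LieModuleEquiv.apply_symm_apply] at h3
    exact Irrep.vec_zero_ne_zero (h3.trans (map_zero ε.toLieModuleHom))
  · rw [mem_highestWeightSpace, ← LieSubmodule.coe_bracket, ← LieSubmodule.coe_bracket]
    have hl : ∀ x : Sl2, ⁅x, ε.symm (Irrep.vec k 0)⁆ = ε.symm ⁅x, Irrep.vec k 0⁆ := fun x =>
      (LieModuleHom.map_lie ε.symm.toLieModuleHom x _).symm
    rw [hl, hl, h1.1, h1.2]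
    constructor
    · exact congrArg Subtype.val (map_smul ε.symm.toLieModuleHom _ _)
    · exact congrArg Subtype.val (map_zero ε.symm.toLieModuleHom)

end Decomposition

/-! ### Multiplicities -/

section Multiplicity

variable {M N : Type} [AddCommGroup M] [Module ℂ M] [LieRingModule Sl2 M] [LieModule ℂ Sl2 M]
  [AddCommGroup N] [Module ℂ N] [LieRingModule Sl2 N] [LieModule ℂ Sl2 N]

theorem IsSimpleDecomposition.iSupIndep_toSubmodule {s : Set (LieSubmodule ℂ Sl2 M)}
    (hs : IsSimpleDecomposition s) : iSupIndep fun W : s => W.1.toSubmodule :=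
  LieSubmodule.iSupIndep_toSubmodule.2 ((sSupIndep_iff _).1 hs.indep)

theorem IsSimpleDecomposition.mem_iSup {s : Set (LieSubmodule ℂ Sl2 M)}
    (hs : IsSimpleDecomposition s) (m : M) : m ∈ ⨆ W : s, W.1.toSubmodule := by
  rw [← LieSubmodule.iSup_toSubmodule, ← sSup_eq_iSup', hs.sSup_eq_top]
  trivial

/-- The components of a highest weight vector are highest weight vectors. -/
theorem IsSimpleDecomposition.exists_components {s : Set (LieSubmodule ℂ Sl2 M)}
    (hs : IsSimpleDecomposition s) {k : ℂ} {m : M} (hm : m ∈ highestWeightSpace M k) :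
    ∃ g : s →₀ M, (∀ W, g W ∈ W.1 ∧ g W ∈ highestWeightSpace M k) ∧ ∑ W ∈ g.support, g W = m := by
  obtain ⟨g, hg, rfl⟩ := (Submodule.mem_iSup_iff_exists_finsupp _ _).1 (hs.mem_iSup m)
  -- The vectors `(h - k) g_W` and `e g_W` stay in `W` and sum over `W` to `(h - k) m = 0` and `e m
  -- = 0`, so independence makes each of them vanish.
  have hind := (iSupIndep_iff_finsetSum_eq_zero_imp_eq_zero _).1 hs.iSupIndep_toSubmodule
  have hm' := mem_highestWeightSpace.1 hm
  refine ⟨g, fun W => ⟨hg W, ?_⟩, rfl⟩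
  by_cases hW : W ∈ g.support
  · rw [mem_highestWeightSpace]
    constructor
    · rw [← sub_eq_zero]
      refine hind g.support (fun W => ⁅Sl2.h, g W⁆ - k • g W)
        (fun V _ => sub_mem (V.1.lie_mem (hg V)) (V.1.smul_mem k (hg V))) ?_ W hW
      rw [Finset.sum_sub_distrib, ← lie_sum, ← Finset.smul_sum, sub_eq_zero]
      exact hm'.1
    · refine hind g.support (fun W => ⁅Sl2.e, g W⁆) (fun V _ => V.1.lie_mem (hg V)) ?_ W hW
      rw [← lie_sum]
      exact hm'.2
  · rw [Finsupp.notMem_support_iff.1 hW]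
    exact zero_mem _

/-- The multiplicity of `L(k)` is the dimension of the space of highest weight vectors of
weight `k`. -/
theorem IsSimpleDecomposition.ncard_summandsOfType (hM : IsIntegrable M)
    {s : Set (LieSubmodule ℂ Sl2 M)} (hs : IsSimpleDecomposition s) (k : ℕ)
    [Module.Finite ℂ (highestWeightSpace M k)] :
    (summandsOfType s (Irrep k)).Finite ∧
      (summandsOfType s (Irrep k)).ncard = Module.finrank ℂ (highestWeightSpace M k) := by
  classical
  have hex : ∀ W : summandsOfType s (Irrep k),
      ∃ m ∈ W.1, m ≠ 0 ∧ m ∈ highestWeightSpace M k := fun W =>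
    exists_highestWeight_of_equiv W.2.2.some
  choose v hvW hv0 hv using hex
  -- One highest weight vector from each summand of type `L(k)` gives a basis. A nonzero component
  -- of a highest weight vector of weight `k` forces its summand to be of type `L(k)`, where highest
  -- weight vectors form a line.
  let b : summandsOfType s (Irrep k) → highestWeightSpace M k := fun W => ⟨v W, hv W⟩
  have hli : LinearIndependent ℂ b := by
    have hind : iSupIndep fun W : summandsOfType s (Irrep k) => W.1.toSubmodule :=
      hs.iSupIndep_toSubmodule.comp (f := fun W : summandsOfType s (Irrep k) =>
        (⟨W.1, W.2.1⟩ : s)) fun V W hVW => Subtype.ext (congrArg (fun x : s => x.1) hVW)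
    have := hind.linearIndependent _ hvW hv0
    exact LinearIndependent.of_comp (highestWeightSpace M k).subtype this
  have hspan : ⊤ ≤ Submodule.span ℂ (Set.range b) := by
    rintro ⟨m, hm⟩ -
    have hmap : m ∈ (Submodule.span ℂ (Set.range b)).map (highestWeightSpace M k).subtype := by
      obtain ⟨g, hg, rfl⟩ := hs.exists_components hm
      refine sum_mem fun W hW => ?_
      have hg0 : g W ≠ 0 := Finsupp.mem_support_iff.1 hW
      have hirr := hs.irreducible W.1 W.2
      have hT : W.1 ∈ summandsOfType s (Irrep k) :=
        ⟨W.2, nonempty_equiv_irrep hM hirr (hg W).2 hg0 (hg W).1⟩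
      have h1 := mem_span_of_highestWeight hM hirr (hv ⟨W.1, hT⟩) (hv0 _) (hvW ⟨W.1, hT⟩)
        (mem_highestWeightSpace.1 (hg W).2).2 (hg W).1
      rw [Submodule.map_span]
      refine Submodule.span_mono ?_ h1
      rw [Set.singleton_subset_iff]
      exact ⟨b ⟨W.1, hT⟩, ⟨_, rfl⟩, rfl⟩
    obtain ⟨m', hm', hmm'⟩ := hmap
    have : m' = ⟨m, hm⟩ := Subtype.ext hmm'
    exact this ▸ hm'
  let B := Module.Basis.mk hli hspan
  have hfin : Finite (summandsOfType s (Irrep k)) := Module.Finite.finite_basis B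
  refine ⟨hfin, ?_⟩
  rw [Module.finrank_eq_nat_card_basis B]
  rfl

theorem IsIntegrable.finite_highestWeightSpace_of_surjective (hM : IsIntegrable M)
    (φ : M →ₗ⁅ℂ,Sl2⁆ N) (hφ : Function.Surjective φ) (k : ℕ)
    [Module.Finite ℂ (highestWeightSpace M k)] :
    Module.Finite ℂ (highestWeightSpace N k) := by
  have hmap : ∀ m ∈ highestWeightSpace M k, (φ : M →ₗ[ℂ] N) m ∈ highestWeightSpace N k :=
    fun m hm => by
      have hm' := mem_highestWeightSpace.1 hm
      rw [mem_highestWeightSpace, LieModuleHom.coe_toLinearMap, ← LieModuleHom.map_lie,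
        ← LieModuleHom.map_lie, hm'.1, hm'.2]
      exact ⟨map_smul φ _ _, map_zero φ⟩
  refine Module.Finite.of_surjective ((φ : M →ₗ[ℂ] N).restrict hmap) ?_
  rintro ⟨q, hq⟩
  obtain ⟨m, hm, rfl⟩ := hM.exists_highestWeight_lift φ hφ hq
  exact ⟨⟨m, hm⟩, Subtype.ext rfl⟩

theorem IsIntegrable.exists_decomposition_finite (hM : IsIntegrable M)
    (hfin : ∀ k : ℕ, Module.Finite ℂ (highestWeightSpace M k)) :
    ∃ s : Set (LieSubmodule ℂ Sl2 M), IsSimpleDecomposition s ∧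
      ∀ W ∈ s, (summandsOfType s W).Finite := by
  obtain ⟨s, hs⟩ := hM.exists_decomposition
  refine ⟨s, hs, fun W hW => ?_⟩
  obtain ⟨-, k, ⟨ε⟩⟩ := finite_of_isIrreducible hM (hs.irreducible W hW)
  have := hfin k
  exact (hs.ncard_summandsOfType hM k).1.subset fun V hV => ⟨hV.1, ⟨hV.2.some.trans ε⟩⟩

end Multiplicity

/-! ### The polynomial model of `Q(0)` -/

section Model

open MvPolynomial

/-- The symmetric algebra of `L(3)`, with the variables `v₃, v₁, v₋₁, v₋₃`. -/
abbrev CubicPoly : Type := MvPolynomial (Fin 4) ℂ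

/-- The basis of `L(3)`. -/
def cubicVec (j : Fin 4) : Irrep 3 := (Pi.single j 1 : Fin (3 + 1) → ℂ)

/-- The inclusion of `L(3)` in its symmetric algebra. -/
def linForm : Irrep 3 →ₗ[ℂ] CubicPoly where
  toFun w := ∑ j : Fin 4, w j • (X j : CubicPoly)
  map_add' v w := by
    rw [← Finset.sum_add_distrib]
    exact Finset.sum_congr rfl fun j _ => add_smul (v j) (w j) _
  map_smul' c w := by
    rw [RingHom.id_apply, Finset.smul_sum]
    exact Finset.sum_congr rfl fun j _ => mul_smul c (w j) _

theorem linForm_apply (w : Irrep 3) : linForm w = ∑ j : Fin 4, w j • (X j : CubicPoly) := rfl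

theorem linForm_cubicVec (j : Fin 4) : linForm (cubicVec j) = X j := by
  rw [linForm_apply, Finset.sum_eq_single j]
  · simp [cubicVec]
  · intro i _ hij
    simp [cubicVec, hij]
  · simp

theorem eq_sum_cubicVec (w : Irrep 3) : w = ∑ j : Fin 4, w j • cubicVec j :=
  pi_eq_sum_univ' (ι := Fin 4) (R := ℂ) w

/-- The derivation of the symmetric algebra given by `x ∈ sl₂`. -/
def derivSl2 (x : Sl2) : Derivation ℂ CubicPoly CubicPoly :=
  mkDerivation ℂ fun j => linForm ⁅x, cubicVec j⁆

theorem derivSl2_X (x : Sl2) (j : Fin 4) : derivSl2 x (X j) = linForm ⁅x, cubicVec j⁆ :=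
  mkDerivation_X _ _ _

theorem derivSl2_linForm (x : Sl2) (w : Irrep 3) : derivSl2 x (linForm w) = linForm ⁅x, w⁆ := by
  conv_rhs => rw [eq_sum_cubicVec w]
  rw [linForm_apply, map_sum, lie_sum, map_sum]
  refine Finset.sum_congr rfl fun j _ => ?_
  rw [Derivation.map_smul, lie_smul, map_smul, derivSl2_X]

theorem derivSl2_add (x y : Sl2) : derivSl2 (x + y) = derivSl2 x + derivSl2 y := by
  refine derivation_ext fun j => ?_
  rw [Derivation.add_apply, derivSl2_X, derivSl2_X, derivSl2_X, add_lie, map_add]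

theorem derivSl2_smul (c : ℂ) (x : Sl2) : derivSl2 (c • x) = c • derivSl2 x := by
  refine derivation_ext fun j => ?_
  rw [Derivation.smul_apply, derivSl2_X, derivSl2_X, smul_lie, map_smul]

theorem derivSl2_lie (x y : Sl2) : derivSl2 ⁅x, y⁆ = ⁅derivSl2 x, derivSl2 y⁆ := by
  refine derivation_ext fun j => ?_
  rw [Derivation.commutator_apply, derivSl2_X, derivSl2_X, derivSl2_X, derivSl2_linForm,
    derivSl2_linForm, lie_lie, map_sub]

/-- `sl₂` acts on the symmetric algebra by derivations, and `L(3)` by multiplication. -/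
instance : LieRingModule (Galilei 3) CubicPoly where
  bracket x p := linForm x.left * p + derivSl2 x.right p
  add_lie x y p := by
    change linForm (x.left + y.left) * p + derivSl2 (x.right + y.right) p = _
    rw [map_add, derivSl2_add, Derivation.add_apply]
    ring
  lie_add x p q := by
    rw [map_add]
    ring
  leibniz_lie x y p := by
    change linForm x.left * (linForm y.left * p + derivSl2 y.right p) +
      derivSl2 x.right (linForm y.left * p + derivSl2 y.right p) =
      linForm (0 + ⁅x.right, y.left⁆ - ⁅y.right, x.left⁆) * p + derivSl2 ⁅x.right, y.right⁆ p +
      (linForm y.left * (linForm x.left * p + derivSl2 x.right p) +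
        derivSl2 y.right (linForm x.left * p + derivSl2 x.right p))
    rw [zero_add, map_sub, derivSl2_lie, Derivation.commutator_apply, map_add, map_add,
      Derivation.leibniz, Derivation.leibniz, derivSl2_linForm, derivSl2_linForm]
    simp only [smul_eq_mul]
    ring

theorem galilei_lie_def (x : Galilei 3) (p : CubicPoly) :
    ⁅x, p⁆ = linForm x.left * p + derivSl2 x.right p := rfl

instance : LieModule ℂ (Galilei 3) CubicPoly where
  smul_lie c x p := by
    change linForm (c • x.left) * p + derivSl2 (c • x.right) p =
      c • (linForm x.left * p + derivSl2 x.right p)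
    rw [map_smul, derivSl2_smul, Derivation.smul_apply, smul_add, smul_mul_assoc]
  lie_smul c x p := by
    rw [galilei_lie_def, galilei_lie_def, Derivation.map_smul, smul_add, mul_smul_comm]

instance : LieRingModule Sl2 CubicPoly := LieRingModule.compLieHom CubicPoly (sl2Incl 3)

instance : LieModule ℂ Sl2 CubicPoly := LieModule.compLieHom CubicPoly (sl2Incl 3)

theorem sl2_lie_eq_derivSl2 (x : Sl2) (p : CubicPoly) : ⁅x, p⁆ = derivSl2 x p := by
  change linForm 0 * p + derivSl2 x p = _
  rw [map_zero, zero_mul, zero_add]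

theorem linForm_eq_coord (w : Irrep 3) :
    linForm w = Irrep.coord w 0 • X 0 + Irrep.coord w 1 • X 1 + Irrep.coord w 2 • X 2 +
      Irrep.coord w 3 • X 3 := by
  rw [linForm_apply, Fin.sum_univ_four]
  rfl

theorem coord_cubicVec (j : Fin 4) (i : ℕ) :
    Irrep.coord (cubicVec j) i = if i = j.1 then 1 else 0 := by
  rcases Nat.lt_or_ge i 4 with hi | hi
  · rw [Irrep.coord, dif_pos hi]
    change (Pi.single j 1 : Fin 4 → ℂ) ⟨i, hi⟩ = _
    rw [Pi.single_apply]
    exact if_congr Fin.ext_iff rfl rfl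
  · rw [Irrep.coord_of_le _ hi, if_neg]
    omega

theorem derivSl2_e_X : derivSl2 Sl2.e (X 0) = 0 ∧ derivSl2 Sl2.e (X 1) = 3 * X 0 ∧
    derivSl2 Sl2.e (X 2) = 2 * X 1 ∧ derivSl2 Sl2.e (X 3) = X 2 := by
  have c2 : (C 2 : CubicPoly) = 2 := map_ofNat C 2
  have c3 : (C 3 : CubicPoly) = 3 := map_ofNat C 3
  refine ⟨?_, ?_, ?_, ?_⟩ <;>
  · rw [derivSl2_X, linForm_eq_coord]
    simp only [Irrep.coord_lie_e, coord_cubicVec]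
    norm_num [smul_eq_C_mul, c2, c3]

theorem derivSl2_f_X : derivSl2 Sl2.f (X 0) = X 1 ∧ derivSl2 Sl2.f (X 1) = 2 * X 2 ∧
    derivSl2 Sl2.f (X 2) = 3 * X 3 ∧ derivSl2 Sl2.f (X 3) = 0 := by
  have h1 : ∀ w : Irrep 3, Irrep.coord ⁅Sl2.f, w⁆ 1 = Irrep.coord w 0 := fun w => by
    rw [Irrep.coord_lie_f_succ w (by norm_num : 0 < 3)]
    simp
  have h2 : ∀ w : Irrep 3, Irrep.coord ⁅Sl2.f, w⁆ 2 = 2 * Irrep.coord w 1 := fun w => by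
    rw [Irrep.coord_lie_f_succ w (by norm_num : 1 < 3)]
    norm_num
  have h3 : ∀ w : Irrep 3, Irrep.coord ⁅Sl2.f, w⁆ 3 = 3 * Irrep.coord w 2 := fun w => by
    rw [Irrep.coord_lie_f_succ w (by norm_num : 2 < 3)]
    norm_num
  have c2 : (C 2 : CubicPoly) = 2 := map_ofNat C 2
  have c3 : (C 3 : CubicPoly) = 3 := map_ofNat C 3
  refine ⟨?_, ?_, ?_, ?_⟩ <;>
  · rw [derivSl2_X, linForm_eq_coord]
    simp only [Irrep.coord_lie_f_zero, h1, h2, h3, coord_cubicVec]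
    simp [smul_eq_C_mul, c2, c3]

theorem derivSl2_h_X (j : Fin 4) :
    derivSl2 Sl2.h (X j) = ((3 : ℂ) - 2 * (j.1 : ℂ)) • X j := by
  rw [derivSl2_X, linForm_eq_coord, Irrep.coord_lie_h _ (by norm_num : 0 < 3 + 1),
    Irrep.coord_lie_h _ (by norm_num : 1 < 3 + 1), Irrep.coord_lie_h _ (by norm_num : 2 < 3 + 1),
    Irrep.coord_lie_h _ (by norm_num : 3 < 3 + 1)]
  fin_cases j <;> simp [coord_cubicVec]

end Model

/-! ### Identification of `Q(0)` with the polynomial model -/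

section Enveloping

open MvPolynomial
open scoped IsMulCommutative

/-- An induction principle for the enveloping algebra: by the universal property `ι` lifts to a map
into `S`, and the lift followed by the inclusion of `S` is the identity. -/
theorem mem_of_forall_ι_mem {L : Type} [LieRing L] [LieAlgebra ℂ L]
    (S : Subalgebra ℂ (UniversalEnvelopingAlgebra ℂ L))
    (hS : ∀ x, UniversalEnvelopingAlgebra.ι ℂ x ∈ S) (u : UniversalEnvelopingAlgebra ℂ L) :
    u ∈ S := by
  let _ := LieRing.ofAssociativeRing (A := UniversalEnvelopingAlgebra ℂ L)
  let _ := LieRing.ofAssociativeRing (A := S)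
  let j : L →ₗ⁅ℂ⁆ S :=
    { toFun := fun x => ⟨UniversalEnvelopingAlgebra.ι ℂ x, hS x⟩
      map_add' := fun x y => Subtype.ext (map_add _ x y)
      map_smul' := fun c x => Subtype.ext (map_smul _ c x)
      map_lie' := fun {x y} => Subtype.ext (LieHom.map_lie _ x y) }
  have h : S.val.comp (UniversalEnvelopingAlgebra.lift ℂ j) = AlgHom.id ℂ _ := by
    apply UniversalEnvelopingAlgebra.hom_ext
    ext x
    change ((UniversalEnvelopingAlgebra.lift ℂ j (UniversalEnvelopingAlgebra.ι ℂ x) : S) :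
      UniversalEnvelopingAlgebra ℂ L) = UniversalEnvelopingAlgebra.ι ℂ x
    rw [UniversalEnvelopingAlgebra.lift_ι_apply]
    rfl
  have h2 := DFunLike.congr_fun h u
  rw [AlgHom.id_apply] at h2
  rw [← h2]
  exact (UniversalEnvelopingAlgebra.lift ℂ j u).2

/-- The enveloping algebra of `L^3`. -/
abbrev UGal : Type := UniversalEnvelopingAlgebra ℂ (Galilei 3)

/-- The canonical map from `L^3` to its enveloping algebra. -/
abbrev ιGal (x : Galilei 3) : UGal := UniversalEnvelopingAlgebra.ι ℂ x

theorem ιGal_lie (x y : Galilei 3) : ιGal ⁅x, y⁆ = ιGal x * ιGal y - ιGal y * ιGal x := by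
  let _ := LieRing.ofAssociativeRing (A := UGal)
  change UniversalEnvelopingAlgebra.ι ℂ ⁅x, y⁆ = _
  rw [LieHom.map_lie, LieRing.of_associative_ring_bracket]

/-- The inclusion of `L(3)` in `L^3`. -/
abbrev radIncl (w : Irrep 3) : Galilei 3 := LieAlgebra.SemiDirectSum.inl (Irrep.derivation 3) w

theorem radVec_eq (j : Fin 4) : radVec 3 j = ιGal (radIncl (cubicVec j)) := rfl

theorem galilei_eq_add (x : Galilei 3) : x = radIncl x.left + sl2Incl 3 x.right := by
  change x = ⟨x.left + 0, 0 + x.right⟩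
  rw [add_zero, zero_add]

theorem ιGal_eq_add (x : Galilei 3) : ιGal x = ιGal (radIncl x.left) + ιGal (sl2Incl 3 x.right) := by
  conv_lhs => rw [galilei_eq_add x]
  exact map_add (UniversalEnvelopingAlgebra.ι ℂ) _ _

theorem radVec_mul_comm (i j : Fin 4) : radVec 3 i * radVec 3 j = radVec 3 j * radVec 3 i := by
  rw [radVec_eq, radVec_eq, ← sub_eq_zero, ← ιGal_lie]
  have : ⁅radIncl (cubicVec i), radIncl (cubicVec j)⁆ = 0 :=
    ((LieAlgebra.SemiDirectSum.inl (Irrep.derivation 3)).map_lie _ _).symm.trans (map_zero _)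
  rw [this]
  exact map_zero (UniversalEnvelopingAlgebra.ι ℂ)

/-- The subalgebra of the enveloping algebra generated by `L(3)`. -/
abbrev radAlgebra : Subalgebra ℂ UGal := Algebra.adjoin ℂ (Set.range (radVec 3))

/-- Polynomials can be evaluated only in a commutative algebra, so `polyToU` goes through this
subalgebra. -/
instance : IsMulCommutative radAlgebra := Algebra.isMulCommutative_adjoin ℂ (by
  rintro _ ⟨i, rfl⟩ _ ⟨j, rfl⟩
  exact radVec_mul_comm i j)

/-- The map from the symmetric algebra of `L(3)` to the enveloping algebra of `L^3`. -/
def polyToU : CubicPoly →ₐ[ℂ] UGal :=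
  radAlgebra.val.comp (aeval fun j => ⟨radVec 3 j, Algebra.subset_adjoin ⟨j, rfl⟩⟩)

theorem polyToU_X (j : Fin 4) : polyToU (X j) = radVec 3 j := by
  rw [polyToU, AlgHom.comp_apply, aeval_X]
  rfl

theorem polyToU_linForm (w : Irrep 3) : polyToU (linForm w) = ιGal (radIncl w) := by
  conv_rhs => rw [eq_sum_cubicVec w]
  rw [linForm_apply, map_sum]
  have h : ιGal (radIncl (∑ j : Fin 4, w j • cubicVec j)) =
      ∑ j : Fin 4, w j • ιGal (radIncl (cubicVec j)) := by
    simp only [ιGal, radIncl, map_sum, map_smul]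
  rw [h]
  refine Finset.sum_congr rfl fun j _ => ?_
  rw [map_smul, polyToU_X, radVec_eq]

/-- The commutator with `x` is a derivation of the enveloping algebra. On the generators it is the
bracket of the semidirect sum, that is `derivSl2 x`, so the two agree on all polynomials. -/
theorem ιGal_mul_polyToU (x : Sl2) (p : CubicPoly) :
    ιGal (sl2Incl 3 x) * polyToU p =
      polyToU p * ιGal (sl2Incl 3 x) + polyToU (derivSl2 x p) := by
  induction p using MvPolynomial.induction_on with
  | C a =>
    rw [← algebraMap_eq, AlgHom.commutes, Derivation.map_algebraMap, map_zero, add_zero,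
      Algebra.commutes]
  | add p q hp hq =>
    rw [map_add, mul_add, hp, hq, map_add, map_add, add_mul]
    abel
  | mul_X p j hp =>
    have hX : ιGal (sl2Incl 3 x) * radVec 3 j =
        radVec 3 j * ιGal (sl2Incl 3 x) + polyToU (derivSl2 x (X j)) := by
      rw [derivSl2_X, polyToU_linForm, radVec_eq, ← sub_eq_iff_eq_add', ← ιGal_lie]
      congr 1
      change (⟨0 + ⁅x, cubicVec j⁆ - ⁅(0 : Sl2), (0 : Irrep 3)⁆, ⁅x, (0 : Sl2)⁆⟩ : Galilei 3) = _
      rw [zero_add, zero_lie, sub_zero, lie_zero]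
      rfl
    rw [Derivation.leibniz, map_mul, map_add, polyToU_X, smul_eq_mul, smul_eq_mul, map_mul,
      mul_comm (X j : CubicPoly), map_mul, polyToU_X, ← mul_assoc, hp, add_mul, mul_assoc, hX,
      mul_add]
    simp only [mul_assoc]
    abel

/-- The action of the enveloping algebra on the polynomial model. -/
def actU : UGal →ₐ[ℂ] Module.End ℂ CubicPoly :=
  UniversalEnvelopingAlgebra.lift ℂ (LieModule.toEnd ℂ (Galilei 3) CubicPoly)

theorem actU_ι (x : Galilei 3) (p : CubicPoly) : actU (ιGal x) p = ⁅x, p⁆ := by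
  rw [actU, ιGal, UniversalEnvelopingAlgebra.lift_ι_apply]
  rfl

theorem actU_polyToU (p q : CubicPoly) : actU (polyToU p) q = p * q := by
  have h : actU.comp polyToU = Algebra.lmul ℂ CubicPoly := by
    refine MvPolynomial.algHom_ext fun j => ?_
    refine LinearMap.ext fun q => ?_
    rw [AlgHom.comp_apply, polyToU_X, radVec_eq, actU_ι, galilei_lie_def]
    change linForm (cubicVec j) * q + derivSl2 0 q = X j * q
    have h0 : derivSl2 0 = 0 := by
      have := derivSl2_smul 0 0
      rwa [zero_smul, zero_smul] at this
    rw [linForm_cubicVec, h0, Derivation.zero_apply, add_zero]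
  exact LinearMap.congr_fun (DFunLike.congr_fun h p) q

/-- The generator of `Q(0)`. -/
def genQ0 : Q0 := Submodule.Quotient.mk ((1 : UGal) ⊗ₜ[ℂ] Irrep.vec 0 0)

theorem irrep_zero_lie (x : Sl2) (m : Irrep 0) : ⁅x, m⁆ = 0 := by
  funext ⟨j, hj⟩
  obtain rfl : j = 0 := by omega
  change Irrep.act x m 0 = 0
  simp [Irrep.act]

theorem sl2_smul_genQ0 (x : Sl2) : ιGal (sl2Incl 3 x) • genQ0 = 0 := by
  rw [genQ0, ← Submodule.Quotient.mk_smul, Submodule.Quotient.mk_eq_zero]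
  refine Submodule.subset_span ⟨1, x, Irrep.vec 0 0, ?_⟩
  rw [irrep_zero_lie, TensorProduct.tmul_zero, sub_zero, one_mul, TensorProduct.smul_tmul',
    smul_eq_mul, mul_one]

/-- The isomorphism from the polynomial model to `Q(0)`, as a linear map. -/
def polyToQ0 : CubicPoly →ₗ[ℂ] Q0 where
  toFun p := polyToU p • genQ0
  map_add' p q := by rw [map_add, add_smul]
  map_smul' c p := by rw [map_smul, smul_assoc, RingHom.id_apply]

theorem polyToQ0_apply (p : CubicPoly) : polyToQ0 p = polyToU p • genQ0 := rfl

/-- After `x ∈ sl₂` is moved to the right of the polynomial it reaches the generator and kills it,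
so only the derivation term remains. -/
theorem polyToQ0_lie (x : Galilei 3) (p : CubicPoly) : polyToQ0 ⁅x, p⁆ = ιGal x • polyToQ0 p := by
  rw [polyToQ0_apply, polyToQ0_apply, galilei_lie_def, map_add, map_mul, polyToU_linForm,
    ιGal_eq_add x, ← mul_smul, add_mul, ιGal_mul_polyToU, add_smul, add_smul, add_smul,
    mul_smul (polyToU p), sl2_smul_genQ0, smul_zero, zero_add]

theorem smul_polyToQ0 (u : UGal) (p : CubicPoly) : u • polyToQ0 p = polyToQ0 (actU u p) := by
  let S : Subalgebra ℂ UGal :=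
    { carrier := {u | ∀ p, u • polyToQ0 p = polyToQ0 (actU u p)}
      mul_mem' := fun {a b} ha hb p => by
        rw [mul_smul, hb, ha, map_mul, Module.End.mul_apply]
      add_mem' := fun {a b} ha hb p => by
        rw [add_smul, hb, ha, map_add, LinearMap.add_apply, map_add]
      algebraMap_mem' := fun c p => by
        rw [AlgHom.commutes, algebraMap_smul, Module.algebraMap_end_apply, map_smul] }
  exact mem_of_forall_ι_mem S (fun x p => by rw [actU_ι, polyToQ0_lie]) u p

theorem polyToQ0_surjective : Function.Surjective polyToQ0 := by
  intro q
  obtain ⟨t, rfl⟩ := Submodule.Quotient.mk_surjective _ q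
  induction t using TensorProduct.induction_on with
  | zero => exact ⟨0, map_zero _⟩
  | add s t hs ht =>
    obtain ⟨p, hp⟩ := hs
    obtain ⟨r, hr⟩ := ht
    exact ⟨p + r, by rw [map_add, hp, hr, Submodule.Quotient.mk_add]⟩
  | tmul u m =>
    refine ⟨Irrep.coord m 0 • actU u 1, ?_⟩
    have hm : m = Irrep.coord m 0 • Irrep.vec 0 0 :=
      Irrep.eq_smul_vec_zero m fun j hj => Irrep.coord_of_le m hj
    rw [map_smul, ← smul_polyToQ0, polyToQ0_apply, map_one, one_smul, genQ0,
      ← Submodule.Quotient.mk_smul, ← Submodule.Quotient.mk_smul, TensorProduct.smul_tmul',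
      smul_eq_mul, mul_one, ← TensorProduct.tmul_smul, ← hm]

/-- The evaluation `u ⊗ m ↦ m u(1)`. -/
def tensorToPoly : UGal ⊗[ℂ] Irrep 0 →ₗ[ℂ] CubicPoly :=
  TensorProduct.lift (LinearMap.mk₂ ℂ (fun (u : UGal) (m : Irrep 0) => Irrep.coord m 0 • actU u 1)
    (fun u v m => by rw [map_add, LinearMap.add_apply, smul_add])
    (fun c u m => by rw [map_smul, LinearMap.smul_apply, smul_comm])
    (fun u m m' => by rw [Irrep.coord_add, add_smul])
    (fun c u m => by rw [Irrep.coord_smul, mul_smul]))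

theorem tensorToPoly_tmul (u : UGal) (m : Irrep 0) :
    tensorToPoly (u ⊗ₜ[ℂ] m) = Irrep.coord m 0 • actU u 1 := rfl

theorem tensorToPoly_smul (u : UGal) (t : UGal ⊗[ℂ] Irrep 0) :
    tensorToPoly (u • t) = actU u (tensorToPoly t) := by
  induction t using TensorProduct.induction_on with
  | zero => rw [smul_zero, map_zero, map_zero]
  | add s t hs ht => rw [smul_add, map_add, hs, ht, map_add, map_add]
  | tmul v m =>
    rw [TensorProduct.smul_tmul', tensorToPoly_tmul, tensorToPoly_tmul, smul_eq_mul, map_mul,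
      Module.End.mul_apply, map_smul]

theorem tensorToPoly_eq_zero {t : UGal ⊗[ℂ] Irrep 0}
    (ht : t ∈ inductionRelations (sl2Incl 3) (Irrep 0)) : tensorToPoly t = 0 := by
  induction ht using Submodule.span_induction with
  | mem t ht =>
    obtain ⟨u, x, m, rfl⟩ := ht
    have h1 : actU (ιGal (sl2Incl 3 x)) 1 = 0 := by
      rw [actU_ι]
      change linForm 0 * 1 + derivSl2 x 1 = 0
      rw [map_zero, zero_mul, Derivation.map_one_eq_zero, zero_add]
    rw [irrep_zero_lie, TensorProduct.tmul_zero, sub_zero, tensorToPoly_tmul, map_mul,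
      Module.End.mul_apply, h1, map_zero, smul_zero]
  | zero => exact map_zero _
  | add s t _ _ hs ht => rw [map_add, hs, ht, add_zero]
  | smul u t _ ht => rw [tensorToPoly_smul, ht, map_zero]

/-- This takes the place of the Poincaré–Birkhoff–Witt theorem. The evaluation `tensorToPoly` kills
the induction relations, because `sl₂` kills the polynomial `1`, and it recovers `p` from `p` times
the generator. -/
theorem polyToQ0_injective : Function.Injective polyToQ0 := by
  rw [← LinearMap.ker_eq_bot, LinearMap.ker_eq_bot']
  intro p hp
  rw [polyToQ0_apply, genQ0, ← Submodule.Quotient.mk_smul, Submodule.Quotient.mk_eq_zero,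
    TensorProduct.smul_tmul', smul_eq_mul, mul_one] at hp
  have := tensorToPoly_eq_zero hp
  rwa [tensorToPoly_tmul, actU_polyToU, mul_one, Irrep.coord_vec le_rfl, if_pos rfl, one_smul] at this

/-- The cubic discriminant in the polynomial model. -/
def discPoly : CubicPoly :=
  X 2 ^ 2 * X 1 ^ 2 - 27 * X 3 ^ 2 * X 0 ^ 2 - 4 * X 2 ^ 3 * X 0 - 4 * X 3 * X 1 ^ 3 +
    18 * X 3 * X 2 * X 1 * X 0

theorem polyToU_discPoly : polyToU discPoly = cubicDiscriminant := by
  simp only [discPoly, cubicDiscriminant, map_add, map_sub, map_mul, map_pow, map_ofNat, polyToU_X]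

theorem derivSl2_e_discPoly : derivSl2 Sl2.e discPoly = 0 := by
  obtain ⟨h0, h1, h2, h3⟩ := derivSl2_e_X
  have hn : ∀ n : ℕ, derivSl2 Sl2.e ((n : ℕ) : CubicPoly) = 0 := fun n => Derivation.map_natCast _ n
  have hn27 := hn 27
  have hn4 := hn 4
  have hn18 := hn 18
  push_cast at hn27 hn4 hn18
  simp only [discPoly, map_add, map_sub, Derivation.leibniz, Derivation.leibniz_pow, h0, h1, h2,
    h3, hn27, hn4, hn18, smul_eq_mul, nsmul_eq_mul]
  push_cast
  ring

theorem derivSl2_f_discPoly : derivSl2 Sl2.f discPoly = 0 := by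
  obtain ⟨h0, h1, h2, h3⟩ := derivSl2_f_X
  have hn : ∀ n : ℕ, derivSl2 Sl2.f ((n : ℕ) : CubicPoly) = 0 := fun n => Derivation.map_natCast _ n
  have hn27 := hn 27
  have hn4 := hn 4
  have hn18 := hn 18
  push_cast at hn27 hn4 hn18
  simp only [discPoly, map_add, map_sub, Derivation.leibniz, Derivation.leibniz_pow, h0, h1, h2,
    h3, hn27, hn4, hn18, smul_eq_mul, nsmul_eq_mul]
  push_cast
  ring

theorem derivSl2_discPoly (x : Sl2) : derivSl2 x discPoly = 0 := by
  rw [← sl2_lie_eq_derivSl2, lie_eq_combination, lie_h_eq]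
  simp only [sl2_lie_eq_derivSl2, derivSl2_e_discPoly, derivSl2_f_discPoly, map_zero, sub_zero,
    smul_zero, add_zero]

/-- The submodule of multiples of `C - χ`. -/
def discMultiples (χ : ℂ) : LieSubmodule ℂ (Galilei 3) CubicPoly where
  __ := (Ideal.span {discPoly - C χ}).restrictScalars ℂ
  lie_mem {x p} hp := by
    obtain ⟨q, rfl⟩ := Ideal.mem_span_singleton.1 hp
    refine Ideal.mem_span_singleton.2 ⟨⁅x, q⁆, ?_⟩
    rw [galilei_lie_def, galilei_lie_def, Derivation.leibniz, map_sub, derivSl2_discPoly,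
      ← algebraMap_eq, Derivation.map_algebraMap]
    simp only [smul_eq_mul]
    ring

theorem mem_discMultiples {χ : ℂ} {p : CubicPoly} :
    p ∈ discMultiples χ ↔ discPoly - C χ ∣ p := Ideal.mem_span_singleton

theorem actU_mem (W : LieSubmodule ℂ (Galilei 3) CubicPoly) (u : UGal) {p : CubicPoly}
    (hp : p ∈ W) : actU u p ∈ W := by
  let S : Subalgebra ℂ UGal :=
    { carrier := {u | ∀ p ∈ W, actU u p ∈ W}
      mul_mem' := fun {a b} ha hb p hp => by
        rw [map_mul, Module.End.mul_apply]
        exact ha _ (hb p hp)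
      add_mem' := fun {a b} ha hb p hp => by
        rw [map_add, LinearMap.add_apply]
        exact add_mem (ha p hp) (hb p hp)
      algebraMap_mem' := fun c p hp => by
        rw [AlgHom.commutes, Module.algebraMap_end_apply]
        exact W.smul_mem c hp }
  exact mem_of_forall_ι_mem S (fun x p hp => by
    rw [actU_ι]
    exact W.lie_mem hp) u p hp

theorem polyToU_disc_sub (χ : ℂ) :
    polyToU (discPoly - C χ) = cubicDiscriminant - algebraMap ℂ _ χ := by
  rw [map_sub, polyToU_discPoly, ← algebraMap_eq, AlgHom.commutes]

variable (χ : ℂ)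

/-- The projection of the polynomial model to `Q(0, χ)`. -/
def polyToQ0χ : CubicPoly →ₗ⁅ℂ,Galilei 3⁆ Q0χ χ where
  toFun p := (Submodule.Quotient.mk (polyToQ0 p) :
    Q0 ⧸ mulSubmodule (cubicDiscriminant - algebraMap ℂ _ χ) Q0)
  map_add' p q := by
    rw [map_add]
    rfl
  map_smul' c p := by
    rw [map_smul]
    rfl
  map_lie' {x p} := by
    change (Submodule.Quotient.mk (polyToQ0 ⁅x, p⁆) :
      Q0 ⧸ mulSubmodule (cubicDiscriminant - algebraMap ℂ _ χ) Q0) = _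
    rw [polyToQ0_lie]
    rfl

theorem polyToQ0χ_surjective : Function.Surjective (polyToQ0χ χ) := fun q => by
  obtain ⟨q', rfl⟩ := Submodule.Quotient.mk_surjective
    (mulSubmodule (cubicDiscriminant - algebraMap ℂ _ χ) Q0) q
  obtain ⟨p, rfl⟩ := polyToQ0_surjective q'
  exact ⟨p, rfl⟩

/-- The element `C - χ` acts on polynomials as multiplication by `D - χ`. Since `D` is invariant,
the ideal of multiples of `D - χ` is stable under all of `L³`, so passing to the generated
`U(L³)`-submodule adds nothing to it. -/
theorem polyToQ0χ_eq_zero_iff (p : CubicPoly) : polyToQ0χ χ p = 0 ↔ discPoly - C χ ∣ p := by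
  have h1 : polyToQ0χ χ p = 0 ↔
      polyToQ0 p ∈ mulSubmodule (cubicDiscriminant - algebraMap ℂ _ χ) Q0 :=
    Submodule.Quotient.mk_eq_zero _
  rw [h1]
  constructor
  · intro hp
    have key : ∀ q ∈ mulSubmodule (cubicDiscriminant - algebraMap ℂ _ χ) Q0,
        ∃ w ∈ discMultiples χ, polyToQ0 w = q := by
      intro q hq
      induction hq using Submodule.span_induction with
      | mem q hq =>
        obtain ⟨q, rfl⟩ := hq
        obtain ⟨r, rfl⟩ := polyToQ0_surjective q
        refine ⟨(discPoly - C χ) * r, mem_discMultiples.2 (dvd_mul_right _ _), ?_⟩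
        rw [polyToQ0_apply, polyToQ0_apply, map_mul, polyToU_disc_sub, mul_smul]
      | zero => exact ⟨0, zero_mem _, map_zero _⟩
      | add s t _ _ hs ht =>
        obtain ⟨v, hv, rfl⟩ := hs
        obtain ⟨w, hw, rfl⟩ := ht
        exact ⟨v + w, add_mem hv hw, map_add _ _ _⟩
      | smul u t _ ht =>
        obtain ⟨w, hw, rfl⟩ := ht
        exact ⟨actU u w, actU_mem _ u hw, (smul_polyToQ0 u w).symm⟩
    obtain ⟨w, hw, hwp⟩ := key _ hp
    exact mem_discMultiples.1 (polyToQ0_injective hwp ▸ hw)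
  · rintro ⟨r, rfl⟩
    refine Submodule.subset_span ⟨polyToQ0 r, ?_⟩
    change _ • _ = _
    rw [polyToQ0_apply, polyToQ0_apply, map_mul, polyToU_disc_sub, mul_smul]

/-- A homomorphism of `L^3`-modules, restricted to `sl₂`. -/
def resHom {M N : Type} [AddCommGroup M] [Module ℂ M] [LieRingModule (Galilei 3) M]
    [LieModule ℂ (Galilei 3) M] [AddCommGroup N] [Module ℂ N] [LieRingModule (Galilei 3) N]
    [LieModule ℂ (Galilei 3) N] (φ : M →ₗ⁅ℂ,Galilei 3⁆ N) :
    Res (sl2Incl 3) M →ₗ⁅ℂ,Sl2⁆ Res (sl2Incl 3) N where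
  __ := (φ : M →ₗ[ℂ] N)
  map_lie' {x p} := φ.map_lie (sl2Incl 3 x) p

end Enveloping

/-! ### Integrability of the polynomial model -/

section PolynomialModel

open MvPolynomial

/-- By the Leibniz rule one application of `D` lowers one of the two exponents. The bound `n + m` is
not sharp, but only local nilpotency matters. -/
theorem derivation_pow_mul_eq_zero (D : Derivation ℂ CubicPoly CubicPoly) (N : ℕ) :
    ∀ n m : ℕ, n + m = N → ∀ p q : CubicPoly, ((D : CubicPoly →ₗ[ℂ] CubicPoly) ^ n) p = 0 →
      ((D : CubicPoly →ₗ[ℂ] CubicPoly) ^ m) q = 0 →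
      ((D : CubicPoly →ₗ[ℂ] CubicPoly) ^ (n + m)) (p * q) = 0 := by
  induction N with
  | zero =>
    intro n m hnm p q hp _
    obtain ⟨rfl, rfl⟩ : n = 0 ∧ m = 0 := by omega
    rw [pow_zero, Module.End.one_apply] at hp
    rw [hp, zero_mul, map_zero]
  | succ N ih =>
    intro n m hnm p q hp hq
    rcases n with _ | n
    · rw [pow_zero, Module.End.one_apply] at hp
      rw [hp, zero_mul, map_zero]
    rcases m with _ | m
    · rw [pow_zero, Module.End.one_apply] at hq
      rw [hq, mul_zero, map_zero]
    rw [pow_succ, Module.End.mul_apply] at hp hq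
    rw [← add_assoc, pow_succ, Module.End.mul_apply, Derivation.coeFn_coe, Derivation.leibniz,
      map_add, smul_eq_mul, smul_eq_mul]
    have h1 := ih (n + 1) m (by omega) p (D q) (by rwa [pow_succ, Module.End.mul_apply]) hq
    have h2 := ih n (m + 1) (by omega) (D p) q hp (by rwa [pow_succ, Module.End.mul_apply])
    rw [h1, zero_add, mul_comm, show n + 1 + m = n + (m + 1) by omega, h2]

/-- The kernel of some power of a derivation. -/
def DerivNilpotent (D : Derivation ℂ CubicPoly CubicPoly) (p : CubicPoly) : Prop :=
  ∃ n : ℕ, ((D : CubicPoly →ₗ[ℂ] CubicPoly) ^ n) p = 0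

variable {D : Derivation ℂ CubicPoly CubicPoly}

theorem DerivNilpotent.mul {p q : CubicPoly} (hp : DerivNilpotent D p) (hq : DerivNilpotent D q) :
    DerivNilpotent D (p * q) := by
  obtain ⟨n, hn⟩ := hp
  obtain ⟨m, hm⟩ := hq
  exact ⟨n + m, derivation_pow_mul_eq_zero D _ n m rfl p q hn hm⟩

theorem DerivNilpotent.add {p q : CubicPoly} (hp : DerivNilpotent D p) (hq : DerivNilpotent D q) :
    DerivNilpotent D (p + q) := by
  obtain ⟨n, hn⟩ := hp
  obtain ⟨m, hm⟩ := hq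
  refine ⟨n + m, ?_⟩
  have hp : ((D : CubicPoly →ₗ[ℂ] CubicPoly) ^ (n + m)) p = 0 := by
    rw [add_comm, pow_add, Module.End.mul_apply, hn, map_zero]
  have hq : ((D : CubicPoly →ₗ[ℂ] CubicPoly) ^ (n + m)) q = 0 := by
    rw [pow_add, Module.End.mul_apply, hm, map_zero]
  rw [map_add, hp, hq, add_zero]

theorem DerivNilpotent.of_apply {p : CubicPoly} (hp : DerivNilpotent D (D p)) :
    DerivNilpotent D p := by
  obtain ⟨n, hn⟩ := hp
  exact ⟨n + 1, by rwa [pow_succ, Module.End.mul_apply]⟩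

theorem DerivNilpotent.of_apply_eq_zero {p : CubicPoly} (hp : D p = 0) : DerivNilpotent D p :=
  ⟨1, by rwa [pow_one]⟩

theorem DerivNilpotent.natCast (n : ℕ) : DerivNilpotent D (n : CubicPoly) :=
  .of_apply_eq_zero (Derivation.map_natCast D n)

theorem derivNilpotent_of_forall_X (hX : ∀ j, DerivNilpotent D (X j)) (p : CubicPoly) :
    DerivNilpotent D p := by
  induction p using MvPolynomial.induction_on with
  | C a => exact .of_apply_eq_zero (by rw [← algebraMap_eq, Derivation.map_algebraMap])
  | add p q hp hq => exact hp.add hq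
  | mul_X p j hp => exact hp.mul (hX j)

theorem derivNilpotent_e (p : CubicPoly) : DerivNilpotent (derivSl2 Sl2.e) p := by
  obtain ⟨h0, h1, h2, h3⟩ := derivSl2_e_X
  have n0 : DerivNilpotent (derivSl2 Sl2.e) (X 0) := .of_apply_eq_zero h0
  have n1 : DerivNilpotent (derivSl2 Sl2.e) (X 1) := .of_apply (h1 ▸ (DerivNilpotent.natCast 3).mul n0)
  have n2 : DerivNilpotent (derivSl2 Sl2.e) (X 2) := .of_apply (h2 ▸ (DerivNilpotent.natCast 2).mul n1)
  have n3 : DerivNilpotent (derivSl2 Sl2.e) (X 3) := .of_apply (h3 ▸ n2)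
  refine derivNilpotent_of_forall_X (fun j => ?_) p
  fin_cases j
  exacts [n0, n1, n2, n3]

theorem derivNilpotent_f (p : CubicPoly) : DerivNilpotent (derivSl2 Sl2.f) p := by
  obtain ⟨h0, h1, h2, h3⟩ := derivSl2_f_X
  have n3 : DerivNilpotent (derivSl2 Sl2.f) (X 3) := .of_apply_eq_zero h3
  have n2 : DerivNilpotent (derivSl2 Sl2.f) (X 2) := .of_apply (h2 ▸ (DerivNilpotent.natCast 3).mul n3)
  have n1 : DerivNilpotent (derivSl2 Sl2.f) (X 1) := .of_apply (h1 ▸ (DerivNilpotent.natCast 2).mul n2)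
  have n0 : DerivNilpotent (derivSl2 Sl2.f) (X 0) := .of_apply (h0 ▸ n1)
  refine derivNilpotent_of_forall_X (fun j => ?_) p
  fin_cases j
  exacts [n0, n1, n2, n3]

theorem toEnd_eq_derivSl2 (x : Sl2) :
    LieModule.toEnd ℂ Sl2 CubicPoly x = (derivSl2 x : CubicPoly →ₗ[ℂ] CubicPoly) :=
  LinearMap.ext fun p => sl2_lie_eq_derivSl2 x p

theorem mem_weightSpace_poly {μ : ℂ} {p : CubicPoly} :
    p ∈ weightSpace CubicPoly μ ↔ derivSl2 Sl2.h p = μ • p := by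
  rw [mem_weightSpace, sl2_lie_eq_derivSl2]

theorem one_mem_weightSpace : (1 : CubicPoly) ∈ weightSpace CubicPoly 0 := by
  rw [mem_weightSpace_poly, Derivation.map_one_eq_zero, zero_smul]

theorem mul_mem_weightSpace {μ ν : ℂ} {p q : CubicPoly} (hp : p ∈ weightSpace CubicPoly μ)
    (hq : q ∈ weightSpace CubicPoly ν) : p * q ∈ weightSpace CubicPoly (μ + ν) := by
  rw [mem_weightSpace_poly] at *
  rw [Derivation.leibniz, hp, hq, smul_eq_mul, smul_eq_mul, mul_smul_comm, mul_smul_comm,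
    mul_comm q p, add_smul, add_comm]

theorem pow_mem_weightSpace {μ : ℂ} {p : CubicPoly} (hp : p ∈ weightSpace CubicPoly μ) (n : ℕ) :
    p ^ n ∈ weightSpace CubicPoly (n * μ) := by
  induction n with
  | zero => simpa using one_mem_weightSpace
  | succ n ih =>
    have := mul_mem_weightSpace ih hp
    rw [pow_succ]
    convert this using 2
    push_cast
    ring

theorem X_mem_weightSpace (j : Fin 4) :
    (X j : CubicPoly) ∈ weightSpace CubicPoly ((3 : ℂ) - 2 * (j.1 : ℂ)) := by
  rw [mem_weightSpace_poly, derivSl2_h_X]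

theorem isIntegrable_poly : IsIntegrable CubicPoly where
  iSup_weightSpace := by
    rw [eq_top_iff]
    intro p _
    induction p using MvPolynomial.induction_on with
    | C a =>
      refine Submodule.mem_iSup_of_mem 0 ?_
      rw [mem_weightSpace_poly, ← algebraMap_eq, Derivation.map_algebraMap, zero_smul]
    | add p q hp hq => exact add_mem (hp trivial) (hq trivial)
    | mul_X p j hp =>
      have hle : (⨆ μ, weightSpace CubicPoly μ).map (LinearMap.mulRight ℂ (X j : CubicPoly)) ≤
          ⨆ μ, weightSpace CubicPoly μ := by
        rw [Submodule.map_iSup]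
        refine iSup_le fun μ => le_trans ?_ (le_iSup _ (μ + ((3 : ℂ) - 2 * (j.1 : ℂ))))
        rintro _ ⟨q, hq, rfl⟩
        exact mul_mem_weightSpace hq (X_mem_weightSpace j)
      exact hle ⟨p, hp trivial, rfl⟩
  e_nilpotent p := by
    rw [actE, toEnd_eq_derivSl2]
    exact derivNilpotent_e p
  f_nilpotent p := by
    rw [actF, toEnd_eq_derivSl2]
    exact derivNilpotent_f p

/-! ### Covariants of binary cubics -/

/-- The leading coefficient of the Hessian of a binary cubic. -/
def hessPoly : CubicPoly := X 1 ^ 2 - 3 * X 0 * X 2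

/-- The leading coefficient of the cubic covariant of a binary cubic. -/
def covPoly : CubicPoly := 27 * X 0 ^ 2 * X 3 - 9 * X 0 * X 1 * X 2 + 2 * X 1 ^ 3

/-- The classical syzygy between the covariants of a binary cubic. It reduces every polynomial in
`T` to degree at most one, which is why the form `U + T V` suffices. -/
theorem covPoly_mul_self :
    covPoly * covPoly = 4 * hessPoly ^ 3 - 27 * X 0 ^ 2 * discPoly := by
  rw [covPoly, hessPoly, discPoly]
  ring

theorem hessPoly_mem_weightSpace : hessPoly ∈ weightSpace CubicPoly 2 := by
  have h2 : (3 : CubicPoly) ∈ weightSpace CubicPoly 0 := by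
    have := Derivation.map_natCast (derivSl2 Sl2.h) 3
    rw [mem_weightSpace_poly, zero_smul]
    exact_mod_cast this
  have hs : X 1 ^ 2 ∈ weightSpace CubicPoly 2 := by
    convert pow_mem_weightSpace (X_mem_weightSpace 1) 2 using 2
    norm_num
  have ht : 3 * X 0 * X 2 ∈ weightSpace CubicPoly 2 := by
    convert mul_mem_weightSpace (mul_mem_weightSpace h2 (X_mem_weightSpace 0))
      (X_mem_weightSpace 2) using 2
    norm_num
  exact sub_mem hs ht

theorem covPoly_mem_weightSpace : covPoly ∈ weightSpace CubicPoly 3 := by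
  have hn : ∀ n : ℕ, (n : CubicPoly) ∈ weightSpace CubicPoly 0 := fun n => by
    rw [mem_weightSpace_poly, zero_smul]
    exact Derivation.map_natCast _ n
  have h1 : ((27 : ℕ) : CubicPoly) * X 0 ^ 2 * X 3 ∈ weightSpace CubicPoly 3 := by
    convert mul_mem_weightSpace (mul_mem_weightSpace (hn 27)
      (pow_mem_weightSpace (X_mem_weightSpace 0) 2)) (X_mem_weightSpace 3) using 2
    norm_num
  have h2 : ((9 : ℕ) : CubicPoly) * X 0 * X 1 * X 2 ∈ weightSpace CubicPoly 3 := by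
    convert mul_mem_weightSpace (mul_mem_weightSpace (mul_mem_weightSpace (hn 9)
      (X_mem_weightSpace 0)) (X_mem_weightSpace 1)) (X_mem_weightSpace 2) using 2
    norm_num
  have h3 : ((2 : ℕ) : CubicPoly) * X 1 ^ 3 ∈ weightSpace CubicPoly 3 := by
    convert mul_mem_weightSpace (hn 2) (pow_mem_weightSpace (X_mem_weightSpace 1) 3) using 2
    norm_num
  exact add_mem (sub_mem h1 h2) h3

theorem derivSl2_e_hessPoly : derivSl2 Sl2.e hessPoly = 0 := by
  obtain ⟨h0, h1, h2, h3⟩ := derivSl2_e_X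
  have hn : derivSl2 Sl2.e (3 : CubicPoly) = 0 := by
    exact_mod_cast Derivation.map_natCast (derivSl2 Sl2.e) 3
  simp only [hessPoly, map_sub, Derivation.leibniz, Derivation.leibniz_pow, h0, h1, h2, hn,
    smul_eq_mul, nsmul_eq_mul]
  push_cast
  ring

theorem derivSl2_e_covPoly : derivSl2 Sl2.e covPoly = 0 := by
  obtain ⟨h0, h1, h2, h3⟩ := derivSl2_e_X
  have hn : ∀ n : ℕ, derivSl2 Sl2.e (n : CubicPoly) = 0 := fun n => Derivation.map_natCast _ n
  have hn27 := hn 27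
  have hn9 := hn 9
  have hn2 := hn 2
  push_cast at hn27 hn9 hn2
  simp only [covPoly, map_add, map_sub, Derivation.leibniz, Derivation.leibniz_pow, h0, h1, h2,
    h3, hn27, hn9, hn2, smul_eq_mul, nsmul_eq_mul]
  push_cast
  ring

/-- The flow of `e` through a point, as a curve. -/
def flowHom (v : Fin 4 → ℂ) : CubicPoly →ₐ[ℂ] Polynomial ℂ :=
  aeval ![Polynomial.C (v 0), Polynomial.C (v 1) + Polynomial.C (3 * v 0) * Polynomial.X,
    Polynomial.C (v 2) + Polynomial.C (2 * v 1) * Polynomial.X +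
      Polynomial.C (3 * v 0) * Polynomial.X ^ 2,
    Polynomial.C (v 3) + Polynomial.C (v 2) * Polynomial.X + Polynomial.C (v 1) * Polynomial.X ^ 2 +
      Polynomial.C (v 0) * Polynomial.X ^ 3]

/-- The curve is an integral curve of the vector field `e`: the identity holds on the variables, and
both sides obey the Leibniz rule. -/
theorem derivative_flowHom (v : Fin 4 → ℂ) (p : CubicPoly) :
    Polynomial.derivative (flowHom v p) = flowHom v (derivSl2 Sl2.e p) := by
  induction p using MvPolynomial.induction_on with
  | C a =>
    rw [← algebraMap_eq, AlgHom.commutes, Derivation.map_algebraMap, map_zero,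
      Polynomial.algebraMap_apply, Polynomial.derivative_C]
  | add p q hp hq => rw [map_add, map_add, hp, hq, map_add, map_add]
  | mul_X p j hp =>
    have hX : Polynomial.derivative (flowHom v (X j)) = flowHom v (derivSl2 Sl2.e (X j)) := by
      obtain ⟨h0, h1, h2, h3⟩ := derivSl2_e_X
      have c2 : (Polynomial.C 2 : Polynomial ℂ) = 2 := map_ofNat _ 2
      have c3 : (Polynomial.C 3 : Polynomial ℂ) = 3 := map_ofNat _ 3
      fin_cases j
      · simp [h0, flowHom]
      · simp [h1, flowHom, c3]
      · simp [h2, flowHom, c2, c3]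
        ring
      · simp [h3, flowHom, c2, c3]
        ring
    rw [map_mul, Polynomial.derivative_mul, hp, hX, Derivation.leibniz, map_add, smul_eq_mul,
      smul_eq_mul, map_mul, map_mul]
    ring

theorem eval_flowHom (v : Fin 4 → ℂ) (p : CubicPoly) (t : ℂ) :
    (flowHom v p).eval t = eval ![v 0, v 1 + 3 * v 0 * t, v 2 + 2 * v 1 * t + 3 * v 0 * t ^ 2,
      v 3 + v 2 * t + v 1 * t ^ 2 + v 0 * t ^ 3] p := by
  induction p using MvPolynomial.induction_on with
  | C a => simp [flowHom]
  | add p q hp hq => rw [map_add, Polynomial.eval_add, hp, hq, map_add]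
  | mul_X p j hp =>
    rw [map_mul, Polynomial.eval_mul, hp, map_mul, eval_X]
    congr 1
    fin_cases j <;> simp [flowHom]

/-- The listed entries are the coefficients of the cubic `v 0 x³ + v 1 x² + v 2 x + v 3` with `x`
replaced by `x + t`. A polynomial killed by `e` has zero derivative along this curve, hence keeps
its value at `t = 0`. -/
theorem eval_flow_eq {p : CubicPoly} (hp : derivSl2 Sl2.e p = 0) (v : Fin 4 → ℂ) (t : ℂ) :
    eval ![v 0, v 1 + 3 * v 0 * t, v 2 + 2 * v 1 * t + 3 * v 0 * t ^ 2,
      v 3 + v 2 * t + v 1 * t ^ 2 + v 0 * t ^ 3] p = eval v p := by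
  have h0 : Polynomial.derivative (flowHom v p) = 0 := by
    rw [derivative_flowHom, hp, map_zero]
  have hc := Polynomial.eq_C_of_derivative_eq_zero h0
  have hv : ![v 0, v 1 + 3 * v 0 * 0, v 2 + 2 * v 1 * 0 + 3 * v 0 * 0 ^ 2,
      v 3 + v 2 * 0 + v 1 * 0 ^ 2 + v 0 * 0 ^ 3] = v := by
    funext j
    fin_cases j <;> simp
  rw [← eval_flowHom]
  conv_rhs => rw [← hv, ← eval_flowHom]
  rw [hc, Polynomial.eval_C, Polynomial.eval_C]

/-- The substitution of `v₃`, the Hessian and the discriminant. -/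
def covHom : MvPolynomial (Fin 3) ℂ →ₐ[ℂ] CubicPoly := aeval ![X 0, hessPoly, discPoly]

theorem covHom_X_zero : covHom (X 0) = X 0 := by simp [covHom]

theorem covHom_X_one : covHom (X 1) = hessPoly := by simp [covHom]

theorem covHom_X_two : covHom (X 2) = discPoly := by simp [covHom]

/-- The polynomials `U + T V`, with `U`, `V` polynomials in `v₃`, the Hessian and the
discriminant, and `T` the cubic covariant. -/
def IsCovariantForm (p : CubicPoly) : Prop :=
  ∃ U V : MvPolynomial (Fin 3) ℂ, p = covHom U + covPoly * covHom V

theorem IsCovariantForm.covHom_mul {p : CubicPoly} (hp : IsCovariantForm p)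
    (W : MvPolynomial (Fin 3) ℂ) : IsCovariantForm (covHom W * p) := by
  obtain ⟨U, V, rfl⟩ := hp
  refine ⟨W * U, W * V, ?_⟩
  rw [map_mul, map_mul]
  ring

theorem IsCovariantForm.covPoly_mul {p : CubicPoly} (hp : IsCovariantForm p) :
    IsCovariantForm (covPoly * p) := by
  obtain ⟨U, V, rfl⟩ := hp
  refine ⟨(4 * X 1 ^ 3 - 27 * X 0 ^ 2 * X 2) * V, U, ?_⟩
  have h : covHom (4 * X 1 ^ 3 - 27 * X 0 ^ 2 * X 2) = covPoly * covPoly := by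
    rw [covPoly_mul_self]
    simp only [map_sub, map_mul, map_pow, map_ofNat, covHom_X_zero, covHom_X_one, covHom_X_two]
  rw [map_mul, h]
  ring

theorem IsCovariantForm.add {p q : CubicPoly} (hp : IsCovariantForm p) (hq : IsCovariantForm q) :
    IsCovariantForm (p + q) := by
  obtain ⟨U, V, rfl⟩ := hp
  obtain ⟨U', V', rfl⟩ := hq
  refine ⟨U + U', V + V', ?_⟩
  rw [map_add, map_add]
  ring

theorem isCovariantForm_C (a : ℂ) : IsCovariantForm (C a) :=
  ⟨C a, 0, by rw [map_zero, mul_zero, add_zero, covHom, aeval_C, algebraMap_eq]⟩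

/-- Evaluation on the slice `v₁ = 0` yields a polynomial in the covariants, up to a power
of `v₃`. -/
theorem exists_covariantForm_slice (p : CubicPoly) :
    ∃ N : ℕ, ∃ g : CubicPoly, IsCovariantForm g ∧ ∀ v : Fin 4 → ℂ, v 0 ≠ 0 →
      eval v g = v 0 ^ N *
        eval ![v 0, 0, -eval v hessPoly / (3 * v 0), eval v covPoly / (27 * v 0 ^ 2)] p := by
  induction p using MvPolynomial.induction_on with
  | C a => exact ⟨0, C a, isCovariantForm_C a, fun v _ => by simp⟩
  | add p q hp hq =>
    obtain ⟨N, g, hg, hgv⟩ := hp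
    obtain ⟨N', g', hg', hgv'⟩ := hq
    refine ⟨N + N', covHom (X 0 ^ N') * g + covHom (X 0 ^ N) * g',
      (hg.covHom_mul _).add (hg'.covHom_mul _), fun v hv => ?_⟩
    simp only [map_add, map_mul, map_pow, covHom_X_zero, eval_X, hgv v hv, hgv' v hv]
    ring
  | mul_X p j hp =>
    obtain ⟨N, g, hg, hgv⟩ := hp
    fin_cases j
    · refine ⟨N, covHom (X 0) * g, hg.covHom_mul _, fun v hv => ?_⟩
      simp [covHom_X_zero, hgv v hv]
      ring
    · refine ⟨N, C 0, isCovariantForm_C 0, fun v hv => ?_⟩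
      simp
    -- The slice coordinate `-H/(3 v₃)` costs one power of `v₃` as a denominator; the last one,
    -- `T/(27 v₃²)`, costs two.
    · refine ⟨N + 1, covHom (C (-1 / 3) * X 1) * g, hg.covHom_mul _, fun v hv => ?_⟩
      have hC : covHom (C (-1 / 3)) = C (-1 / 3) := by rw [covHom, aeval_C, algebraMap_eq]
      simp only [map_mul, covHom_X_one, hC, eval_C, hgv v hv, Fin.reduceFinMk, eval_X,
        Matrix.cons_val]
      field_simp
      ring
    · refine ⟨N + 2, covHom (C (1 / 27)) * (covPoly * g), hg.covPoly_mul.covHom_mul _,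
        fun v hv => ?_⟩
      have hC : covHom (C (1 / 27)) = C (1 / 27) := by rw [covHom, aeval_C, algebraMap_eq]
      simp only [map_mul, hC, eval_C, hgv v hv, Fin.reduceFinMk, eval_X, Matrix.cons_val]
      field_simp
      ring

theorem eq_of_eval_eq_of_ne_zero {p q : CubicPoly}
    (h : ∀ v : Fin 4 → ℂ, v 0 ≠ 0 → eval v p = eval v q) : p = q := by
  have h1 : X 0 * p = X 0 * q := by
    refine MvPolynomial.funext fun v => ?_
    rw [map_mul, map_mul, eval_X]
    by_cases hv : v 0 = 0
    · rw [hv, zero_mul, zero_mul]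
    · rw [h v hv]
  exact mul_left_cancel₀ (X_ne_zero 0) h1

/-- Completing the cube: where `v 0 ≠ 0`, the translation by `t = -v 1/(3 v 0)` reaches the slice
`v₁ = 0` without changing `p`. On the slice the coefficients are rational in `v₃`, `H`, `T`, with
only powers of `v₃` in the denominators. -/
theorem exists_pow_mul_covariantForm {p : CubicPoly} (hp : derivSl2 Sl2.e p = 0) :
    ∃ N : ℕ, IsCovariantForm (X 0 ^ N * p) := by
  obtain ⟨N, g, hg, hgv⟩ := exists_covariantForm_slice p
  refine ⟨N, ?_⟩
  convert hg using 1
  refine eq_of_eval_eq_of_ne_zero fun v hv => ?_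
  have h1 : v 1 + 3 * v 0 * (-v 1 / (3 * v 0)) = 0 := by
    field_simp
    ring
  have h2 : v 2 + 2 * v 1 * (-v 1 / (3 * v 0)) + 3 * v 0 * (-v 1 / (3 * v 0)) ^ 2 =
      -eval v hessPoly / (3 * v 0) := by
    simp [hessPoly]
    field_simp
    ring
  have h3 : v 3 + v 2 * (-v 1 / (3 * v 0)) + v 1 * (-v 1 / (3 * v 0)) ^ 2 +
      v 0 * (-v 1 / (3 * v 0)) ^ 3 = eval v covPoly / (27 * v 0 ^ 2) := by
    simp [covPoly]
    field_simp
    ring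
  rw [hgv v hv, map_mul, map_pow, eval_X, ← eval_flow_eq hp v (-v 1 / (3 * v 0)), h1, h2, h3]

theorem exists_eq_X_zero_mul_add (U : MvPolynomial (Fin 3) ℂ) :
    ∃ W, U = X 0 * W + aeval ![0, X 1, X 2] U := by
  induction U using MvPolynomial.induction_on with
  | C a => exact ⟨0, by rw [mul_zero, zero_add, aeval_C, algebraMap_eq]⟩
  | add p q hp hq =>
    obtain ⟨W, hW⟩ := hp
    obtain ⟨W', hW'⟩ := hq
    exact ⟨W + W', by rw [map_add]; linear_combination hW + hW'⟩
  | mul_X p j hp =>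
    obtain ⟨W, hW⟩ := hp
    fin_cases j
    · exact ⟨p, by simp [mul_comm]⟩
    · refine ⟨W * X 1, ?_⟩
      simp only [Fin.mk_one, map_mul, aeval_X, Matrix.cons_val]
      linear_combination X 1 * hW
    · refine ⟨W * X 2, ?_⟩
      simp only [Fin.reduceFinMk, map_mul, aeval_X, Matrix.cons_val]
      linear_combination X 2 * hW

/-- Vanishing on the part `h ≠ 0` of the plane is enough, since `X 1` times the restriction of `U`
to the plane then vanishes identically. The condition `h ≠ 0` leaves room for points where `H` is
inverted. -/
theorem X_zero_dvd_of_eval {U : MvPolynomial (Fin 3) ℂ}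
    (hU : ∀ h c : ℂ, h ≠ 0 → eval ![0, h, c] U = 0) : X 0 ∣ U := by
  obtain ⟨W, hW⟩ := exists_eq_X_zero_mul_add U
  have h0 : X 1 * aeval ![(0 : MvPolynomial (Fin 3) ℂ), X 1, X 2] U = 0 := by
    refine MvPolynomial.funext fun v => ?_
    rw [map_mul, eval_X, map_zero]
    by_cases hv : v 1 = 0
    · rw [hv, zero_mul]
    · have h1 := congrArg (eval ![0, v 1, v 2]) hW
      have h2 : ∀ p : MvPolynomial (Fin 3) ℂ,
          eval v (aeval ![(0 : MvPolynomial (Fin 3) ℂ), X 1, X 2] p) = eval ![0, v 1, v 2] p :=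
        fun p => by
          induction p using MvPolynomial.induction_on with
          | C a => simp
          | add p q hp hq => rw [map_add, map_add, hp, hq, map_add]
          | mul_X p j hp =>
            rw [map_mul, map_mul, hp, map_mul, eval_X]
            congr 1
            fin_cases j <;> simp
      rw [h2, hU _ _ hv, mul_zero]
  rcases mul_eq_zero.1 h0 with h | h
  · exact absurd h (X_ne_zero 1)
  · rw [h, add_zero] at hW
    exact ⟨W, hW⟩

theorem eval_covHom (v : Fin 4 → ℂ) (U : MvPolynomial (Fin 3) ℂ) :
    eval v (covHom U) = eval ![v 0, eval v hessPoly, eval v discPoly] U := by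
  induction U using MvPolynomial.induction_on with
  | C a => simp [covHom]
  | add p q hp hq => rw [map_add, map_add, hp, hq, map_add]
  | mul_X p j hp =>
    rw [map_mul, map_mul, hp, map_mul, eval_X]
    congr 1
    fin_cases j <;> simp [covHom]

/-- On the hyperplane `v₃ = 0` one has `H = v₁²` and `T = 2v₁³`, while `D` is still free. Changing
the sign of `v₁` changes only the sign of `T`, so `U + T V = 0` there forces `U` and `V` to vanish
at `X 0 = 0` separately, and `X 0` can be cancelled. -/
theorem IsCovariantForm.of_X_zero_mul {p : CubicPoly} (hp : IsCovariantForm (X 0 * p)) :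
    IsCovariantForm p := by
  obtain ⟨U, V, hUV⟩ := hp
  have key : ∀ s c : ℂ, s ≠ 0 →
      eval ![0, s ^ 2, c] U + 2 * s ^ 3 * eval ![0, s ^ 2, c] V = 0 := fun s c hs => by
    -- A point of the hyperplane with `H = s²`, `T = 2s³` and prescribed discriminant `c`.
    have h1 := congrArg (eval ![0, s, 0, -c / (4 * s ^ 3)]) hUV
    have hH : eval ![0, s, 0, -c / (4 * s ^ 3)] hessPoly = s ^ 2 := by simp [hessPoly]
    have hC : eval ![0, s, 0, -c / (4 * s ^ 3)] discPoly = c := by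
      simp [discPoly]
      field_simp
    have hT : eval ![0, s, 0, -c / (4 * s ^ 3)] covPoly = 2 * s ^ 3 := by simp [covPoly]
    rw [map_add, map_mul, map_mul, eval_covHom, eval_covHom, hH, hC, hT, eval_X] at h1
    simpa using h1.symm
  have hU : ∀ h c : ℂ, h ≠ 0 → eval ![0, h, c] U = 0 ∧ eval ![0, h, c] V = 0 := by
    intro h c hh
    obtain ⟨s, rfl⟩ := IsAlgClosed.exists_pow_nat_eq h (n := 2) two_pos
    have hs : s ≠ 0 := by
      rintro rfl
      simp at hh
    have k1 := key s c hs
    have k2 := key (-s) c (neg_ne_zero.2 hs)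
    rw [neg_sq] at k2
    have k3 : eval ![0, s ^ 2, c] U = 0 := by linear_combination (k1 + k2) / 2
    refine ⟨k3, ?_⟩
    rw [k3, zero_add] at k1
    exact (mul_eq_zero.1 k1).resolve_left (by simp [hs])
  obtain ⟨U', rfl⟩ := X_zero_dvd_of_eval fun h c hh => (hU h c hh).1
  obtain ⟨V', rfl⟩ := X_zero_dvd_of_eval fun h c hh => (hU h c hh).2
  refine ⟨U', V', mul_left_cancel₀ (X_ne_zero (0 : Fin 4)) (hUV.trans ?_)⟩
  rw [map_mul, map_mul, covHom_X_zero]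
  ring

/-- The ring of seminvariants of the binary cubic. -/
theorem isCovariantForm_of_lie_e {p : CubicPoly} (hp : derivSl2 Sl2.e p = 0) :
    IsCovariantForm p := by
  obtain ⟨N, hN⟩ := exists_pow_mul_covariantForm hp
  induction N with
  | zero => simpa using hN
  | succ N ih =>
    rw [pow_succ', mul_assoc] at hN
    exact ih hN.of_X_zero_mul

end PolynomialModel

/-! ### Highest weight vectors of `Q(0, χ)` -/

section HighestWeight

open MvPolynomial

/-- The substitution of `v₃` and the Hessian. -/
def seminvHom : MvPolynomial (Fin 2) ℂ →ₐ[ℂ] CubicPoly := aeval ![X 0, hessPoly]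

/-- The map `(U, V) ↦ U + T V`, where `T` is the cubic covariant and `v₃` and the Hessian are
substituted in `U` and `V`. -/
def seminvForm : MvPolynomial (Fin 2) ℂ × MvPolynomial (Fin 2) ℂ →ₗ[ℂ] CubicPoly :=
  LinearMap.coprod seminvHom.toLinearMap
    (LinearMap.mulLeft ℂ covPoly ∘ₗ seminvHom.toLinearMap)

theorem seminvForm_apply (U V : MvPolynomial (Fin 2) ℂ) :
    seminvForm (U, V) = seminvHom U + covPoly * seminvHom V := rfl

theorem disc_sub_dvd_covHom_sub (χ : ℂ) (W : MvPolynomial (Fin 3) ℂ) :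
    discPoly - C χ ∣ covHom W - seminvHom (aeval ![X 0, X 1, C χ] W) := by
  rw [← Ideal.mem_span_singleton, ← Ideal.Quotient.eq]
  have h : (Ideal.Quotient.mkₐ ℂ (Ideal.span {discPoly - C χ})).comp covHom =
      (Ideal.Quotient.mkₐ ℂ (Ideal.span {discPoly - C χ})).comp
        (seminvHom.comp (aeval ![X 0, X 1, C χ])) := by
    refine MvPolynomial.algHom_ext fun j => ?_
    simp only [AlgHom.comp_apply, Ideal.Quotient.mkₐ_eq_mk]
    fin_cases j
    · simp [covHom, seminvHom]
    · simp [covHom, seminvHom]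
    · simp only [Fin.reduceFinMk, covHom_X_two, aeval_X, Matrix.cons_val]
      rw [seminvHom, aeval_C, algebraMap_eq, Ideal.Quotient.eq]
      exact Ideal.mem_span_singleton_self _
  exact DFunLike.congr_fun h W

theorem eval_seminvHom (v : Fin 4 → ℂ) (U : MvPolynomial (Fin 2) ℂ) :
    eval v (seminvHom U) = eval ![v 0, eval v hessPoly] U := by
  induction U using MvPolynomial.induction_on with
  | C a => simp [seminvHom]
  | add p q hp hq => rw [map_add, map_add, hp, hq, map_add]
  | mul_X p j hp =>
    rw [map_mul, map_mul, hp, map_mul, eval_X]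
    congr 1
    fin_cases j <;> simp [seminvHom]

/-- For `a ≠ 0` and any `h`, let `t` be a square root of `4h³ - 27χa²`. The depressed cubic with
coefficients `a, 0, -h/(3a), t/(27a²)` lies on `D = χ` and has `v₃ = a`, `H = h`, `T = t`. Using
both signs of `t` separates `U` from `T V`. -/
theorem eq_zero_of_disc_sub_dvd {χ : ℂ} {U V : MvPolynomial (Fin 2) ℂ}
    (hUV : discPoly - C χ ∣ seminvForm (U, V)) : U = 0 ∧ V = 0 := by
  obtain ⟨q, hq⟩ := hUV
  have key : ∀ a h t : ℂ, a ≠ 0 → t ^ 2 = 4 * h ^ 3 - 27 * χ * a ^ 2 →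
      eval ![a, h] U + t * eval ![a, h] V = 0 := fun a h t ha ht => by
    have h1 := congrArg (eval ![a, 0, -h / (3 * a), t / (27 * a ^ 2)]) hq
    have hH : eval ![a, 0, -h / (3 * a), t / (27 * a ^ 2)] hessPoly = h := by
      simp [hessPoly]
      field_simp
    have hT : eval ![a, 0, -h / (3 * a), t / (27 * a ^ 2)] covPoly = t := by
      simp [covPoly]
      field_simp
    have hC : eval ![a, 0, -h / (3 * a), t / (27 * a ^ 2)] discPoly = χ := by
      simp [discPoly]
      field_simp
      linear_combination (-27 : ℂ) * ht
    rw [seminvForm_apply, map_add, map_mul, eval_seminvHom, eval_seminvHom, hH, hT, map_mul,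
      map_sub, hC, eval_C, sub_self, zero_mul] at h1
    simpa using h1
  have key2 : ∀ a h : ℂ, a ≠ 0 → eval ![a, h] U = 0 ∧
      (4 * h ^ 3 - 27 * χ * a ^ 2) * eval ![a, h] V = 0 := fun a h ha => by
    obtain ⟨t, ht⟩ := IsAlgClosed.exists_pow_nat_eq (4 * h ^ 3 - 27 * χ * a ^ 2) (n := 2) two_pos
    have k1 := key a h t ha ht
    have k2 := key a h (-t) ha (by rw [neg_sq, ht])
    -- The difference of the two relations gives `t V = 0`; multiplying by `t` avoids the case `t =
    -- 0` and leaves a polynomial factor `t²`.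
    refine ⟨by linear_combination (k1 + k2) / 2, ?_⟩
    rw [← ht]
    linear_combination t * (k1 - k2) / 2
  have hv : ∀ v : Fin 2 → ℂ, v = ![v 0, v 1] := fun v => by
    funext j
    fin_cases j <;> rfl
  have hU : X 0 * U = 0 := by
    refine MvPolynomial.funext fun v => ?_
    rw [map_mul, eval_X, map_zero]
    by_cases h0 : v 0 = 0
    · rw [h0, zero_mul]
    · rw [hv v, (key2 (v 0) (v 1) h0).1, mul_zero]
  have hV : X 0 * ((4 * X 1 ^ 3 - 27 * C χ * X 0 ^ 2) * V) = 0 := by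
    refine MvPolynomial.funext fun v => ?_
    rw [map_mul, eval_X, map_zero]
    by_cases h0 : v 0 = 0
    · rw [h0, zero_mul]
    · have := (key2 (v 0) (v 1) h0).2
      rw [← hv v] at this
      simp only [map_mul, map_sub, map_pow, map_ofNat, eval_X, eval_C]
      rw [this, mul_zero]
  refine ⟨(mul_eq_zero.1 hU).resolve_left (X_ne_zero 0),
    (mul_eq_zero.1 ((mul_eq_zero.1 hV).resolve_left (X_ne_zero 0))).resolve_left fun h0 => ?_⟩
  have := congrArg (eval ![0, 1]) h0
  simp at this

/-- The index set of the standard seminvariants `v₃ ^ i H ^ j` and `T v₃ ^ i H ^ j`. -/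
abbrev SeminvIndex : Type := (Fin 2 →₀ ℕ) ⊕ (Fin 2 →₀ ℕ)

/-- The standard seminvariants `v₃ ^ i H ^ j` and `T v₃ ^ i H ^ j`. -/
def seminv (x : SeminvIndex) : CubicPoly :=
  seminvForm (((basisMonomials (Fin 2) ℂ).prod (basisMonomials (Fin 2) ℂ)) x)

/-- The weights of the standard seminvariants. -/
def seminvWeight : SeminvIndex → ℕ
  | Sum.inl m => 3 * m 0 + 2 * m 1
  | Sum.inr m => 3 * m 0 + 2 * m 1 + 3

theorem seminvHom_monomial (m : Fin 2 →₀ ℕ) :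
    seminvHom (monomial m 1) = X 0 ^ m 0 * hessPoly ^ m 1 := by
  rw [seminvHom, aeval_monomial, map_one, one_mul, Finsupp.prod_pow, Fin.prod_univ_two]
  simp

theorem seminv_inl (m : Fin 2 →₀ ℕ) : seminv (Sum.inl m) = X 0 ^ m 0 * hessPoly ^ m 1 := by
  simp [seminv, Module.Basis.prod_apply, seminvForm_apply, seminvHom_monomial]

theorem seminv_inr (m : Fin 2 →₀ ℕ) :
    seminv (Sum.inr m) = covPoly * (X 0 ^ m 0 * hessPoly ^ m 1) := by
  simp [seminv, Module.Basis.prod_apply, seminvForm_apply, seminvHom_monomial]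

theorem seminv_mem_highestWeightSpace (x : SeminvIndex) :
    seminv x ∈ highestWeightSpace CubicPoly (seminvWeight x) := by
  have h0 := derivSl2_e_X.1
  have hw0 : (X 0 : CubicPoly) ∈ weightSpace CubicPoly 3 := by
    simpa using X_mem_weightSpace 0
  have hw : ∀ m : Fin 2 →₀ ℕ, (X 0 ^ m 0 * hessPoly ^ m 1 : CubicPoly) ∈
      weightSpace CubicPoly (((m 0 : ℕ) : ℂ) * 3 + ((m 1 : ℕ) : ℂ) * 2) := fun m =>
    mul_mem_weightSpace (pow_mem_weightSpace hw0 _) (pow_mem_weightSpace hessPoly_mem_weightSpace _)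
  have he : ∀ m : Fin 2 →₀ ℕ, derivSl2 Sl2.e (X 0 ^ m 0 * hessPoly ^ m 1 : CubicPoly) = 0 :=
    fun m => by
      rw [Derivation.leibniz, Derivation.leibniz_pow, Derivation.leibniz_pow, h0,
        derivSl2_e_hessPoly]
      simp
  rcases x with m | m
  · refine Submodule.mem_inf.2 ⟨?_, ?_⟩
    · rw [seminv_inl]
      convert hw m using 2
      simp only [seminvWeight]
      push_cast
      ring
    · rw [LinearMap.mem_ker, toEnd_eq_derivSl2, seminv_inl]
      exact he m
  · refine Submodule.mem_inf.2 ⟨?_, ?_⟩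
    · rw [seminv_inr]
      convert mul_mem_weightSpace covPoly_mem_weightSpace (hw m) using 2
      simp only [seminvWeight]
      push_cast
      ring
    · rw [LinearMap.mem_ker, toEnd_eq_derivSl2, seminv_inr, Derivation.coeFn_coe,
        Derivation.leibniz, he m, derivSl2_e_covPoly, smul_zero, smul_zero, add_zero]

variable (χ : ℂ)

/-- The projection of the polynomial model to `Q(0, χ)`, as a homomorphism of `sl₂`-modules. -/
abbrev projQ0χ : CubicPoly →ₗ⁅ℂ,Sl2⁆ Res (sl2Incl 3) (Q0χ χ) := resHom (polyToQ0χ χ)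

theorem projQ0χ_surjective : Function.Surjective (projQ0χ χ) := polyToQ0χ_surjective χ

theorem projQ0χ_eq_zero_iff (p : CubicPoly) : projQ0χ χ p = 0 ↔ discPoly - C χ ∣ p :=
  polyToQ0χ_eq_zero_iff χ p

theorem isIntegrable_Q0χ : IsIntegrable (Res (sl2Incl 3) (Q0χ χ)) :=
  isIntegrable_poly.of_surjective _ (projQ0χ_surjective χ)

theorem linearIndependent_seminv :
    LinearIndependent ℂ fun x : SeminvIndex => projQ0χ χ (seminv x) := by
  let B := (basisMonomials (Fin 2) ℂ).prod (basisMonomials (Fin 2) ℂ)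
  have hker : LinearMap.ker
      ((projQ0χ χ : CubicPoly →ₗ[ℂ] Res (sl2Incl 3) (Q0χ χ)) ∘ₗ seminvForm) = ⊥ := by
    rw [LinearMap.ker_eq_bot']
    rintro ⟨U, V⟩ hUV
    obtain ⟨rfl, rfl⟩ := eq_zero_of_disc_sub_dvd ((projQ0χ_eq_zero_iff χ _).1 hUV)
    rfl
  exact B.linearIndependent.map' _ hker

theorem projQ0χ_mem_span {p : CubicPoly} (hp : derivSl2 Sl2.e p = 0) :
    projQ0χ χ p ∈ Submodule.span ℂ (Set.range fun x : SeminvIndex => projQ0χ χ (seminv x)) := by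
  obtain ⟨U, V, rfl⟩ := isCovariantForm_of_lie_e hp
  let U' : MvPolynomial (Fin 2) ℂ := aeval ![X 0, X 1, C χ] U
  let V' : MvPolynomial (Fin 2) ℂ := aeval ![X 0, X 1, C χ] V
  have h1 : projQ0χ χ (covHom U + covPoly * covHom V) = projQ0χ χ (seminvForm (U', V')) := by
    rw [← sub_eq_zero, ← map_sub, projQ0χ_eq_zero_iff, seminvForm_apply]
    have := dvd_add (disc_sub_dvd_covHom_sub χ U)
      (dvd_mul_of_dvd_right (disc_sub_dvd_covHom_sub χ V) covPoly)
    convert this using 1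
    ring
  rw [h1]
  let B := (basisMonomials (Fin 2) ℂ).prod (basisMonomials (Fin 2) ℂ)
  have h2 : (U', V') ∈ Submodule.span ℂ (Set.range B) := B.mem_span _
  have h3 := Submodule.mem_map_of_mem
    (f := (projQ0χ χ : CubicPoly →ₗ[ℂ] Res (sl2Incl 3) (Q0χ χ)) ∘ₗ seminvForm) h2
  rw [Submodule.map_span, ← Set.range_comp] at h3
  exact h3

/-- The standard seminvariants of weight `k`. -/
abbrev SeminvOfWeight (k : ℕ) : Type := {x : SeminvIndex // seminvWeight x = k}

theorem highestWeightSpace_Q0χ (k : ℕ) :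
    highestWeightSpace (Res (sl2Incl 3) (Q0χ χ)) k =
      Submodule.span ℂ (Set.range fun x : SeminvOfWeight k => projQ0χ χ (seminv x.1)) := by
  have hwt : ∀ x : SeminvIndex, projQ0χ χ (seminv x) ∈
      highestWeightSpace (Res (sl2Incl 3) (Q0χ χ)) (seminvWeight x) := fun x => by
    have h1 := mem_highestWeightSpace.1 (seminv_mem_highestWeightSpace x)
    rw [mem_highestWeightSpace, ← LieModuleHom.map_lie, ← LieModuleHom.map_lie, h1.1, h1.2]
    exact ⟨map_smul (projQ0χ χ) _ _, map_zero (projQ0χ χ)⟩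
  apply le_antisymm
  · intro q hq
    obtain ⟨p, hp, rfl⟩ := isIntegrable_poly.exists_highestWeight_lift (projQ0χ χ)
      (projQ0χ_surjective χ) hq
    have hp' := (mem_highestWeightSpace.1 hp).2
    rw [sl2_lie_eq_derivSl2] at hp'
    obtain ⟨c, hc⟩ := (Finsupp.mem_span_range_iff_exists_finsupp).1 (projQ0χ_mem_span χ hp')
    have hk := (mem_highestWeightSpace.1 hq).1
    rw [← hc, Finsupp.sum] at hk ⊢
    -- Applying `h - k` to the expansion multiplies each coefficient by the weight minus `k`; linear
    -- independence then leaves only seminvariants of weight `k`.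
    have hzero : ∑ x ∈ c.support, (((seminvWeight x : ℂ) - k) * c x) • projQ0χ χ (seminv x) = 0 := by
      rw [lie_sum, Finset.smul_sum, ← sub_eq_zero, ← Finset.sum_sub_distrib] at hk
      rw [← hk]
      refine Finset.sum_congr rfl fun x _ => ?_
      rw [lie_smul, (mem_highestWeightSpace.1 (hwt x)).1, smul_smul, smul_smul, ← sub_smul]
      congr 1
      ring
    have hcoef := linearIndependent_iff'.1 (linearIndependent_seminv χ) c.support _ hzero
    refine sum_mem fun x hx => Submodule.smul_mem _ _ (Submodule.subset_span ⟨⟨x, ?_⟩, rfl⟩)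
    have h1 := (mul_eq_zero.1 (hcoef x hx)).resolve_right (Finsupp.mem_support_iff.1 hx)
    exact_mod_cast sub_eq_zero.1 h1
  · rw [Submodule.span_le]
    rintro _ ⟨⟨x, rfl⟩, rfl⟩
    exact hwt x

/-- The exponent vector `(i, j)`. -/
def exponentPair (i j : ℕ) : Fin 2 →₀ ℕ := Finsupp.equivFunOnFinite.symm ![i, j]

theorem exponentPair_zero (i j : ℕ) : exponentPair i j 0 = i := rfl

theorem exponentPair_one (i j : ℕ) : exponentPair i j 1 = j := rfl

theorem exponentPair_ext {m : Fin 2 →₀ ℕ} {i j : ℕ} (h0 : m 0 = i) (h1 : m 1 = j) :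
    exponentPair i j = m := by
  ext x
  fin_cases x
  · exact h0.symm
  · exact h1.symm

/-- The equation `3i + 2j = k` forces `i ≡ k` modulo 2, and `3i + 2j + 3 = k` forces the opposite
parity, so the exponent `i` of `v₃` alone determines the seminvariant. With `k = 3m + r`, `r < 3`,
all `i < m` occur, and `i = m` occurs exactly when `r ≠ 1`: an initial segment of length `k + 1 -
2⌊(k+2)/3⌋`. -/
theorem exists_bijective_seminvOfWeight (k : ℕ) :
    ∃ φ : Fin (k + 1 - 2 * ((k + 2) / 3)) → SeminvOfWeight k, Function.Bijective φ := by
  let ψ : ℕ → SeminvIndex := fun i =>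
    if (i + k) % 2 = 0 then Sum.inl (exponentPair i ((k - 3 * i) / 2))
    else Sum.inr (exponentPair i ((k - 3 - 3 * i) / 2))
  have hψ : ∀ i < k + 1 - 2 * ((k + 2) / 3), seminvWeight (ψ i) = k := fun i hi => by
    by_cases h : (i + k) % 2 = 0
    · simp only [ψ, if_pos h, seminvWeight, exponentPair_zero, exponentPair_one]
      omega
    · simp only [ψ, if_neg h, seminvWeight, exponentPair_zero, exponentPair_one]
      omega
  refine ⟨fun i => ⟨ψ i, hψ i i.2⟩, ?_, ?_⟩
  · intro i j hij
    have h1 : ψ i = ψ j := congrArg Subtype.val hij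
    have h2 : ∀ i, Sum.elim (fun m : Fin 2 →₀ ℕ => m 0) (fun m => m 0) (ψ i) = i := fun i => by
      by_cases h : (i + k) % 2 = 0
      · simp only [ψ, if_pos h, Sum.elim_inl, exponentPair_zero]
      · simp only [ψ, if_neg h, Sum.elim_inr, exponentPair_zero]
    exact Fin.ext (by rw [← h2 i, h1, h2 j])
  · rintro ⟨m | m, hm⟩
    · simp only [seminvWeight] at hm
      refine ⟨⟨m 0, by omega⟩, Subtype.ext ?_⟩
      have h : (m 0 + k) % 2 = 0 := by omega
      simp only [ψ, if_pos h]
      exact congrArg Sum.inl (exponentPair_ext rfl (by omega))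
    · simp only [seminvWeight] at hm
      refine ⟨⟨m 0, by omega⟩, Subtype.ext ?_⟩
      have h : ¬ (m 0 + k) % 2 = 0 := by omega
      simp only [ψ, if_neg h]
      exact congrArg Sum.inr (exponentPair_ext rfl (by omega))

theorem finrank_highestWeightSpace_Q0χ (k : ℕ) :
    Module.Finite ℂ (highestWeightSpace (Res (sl2Incl 3) (Q0χ χ)) k) ∧
      Module.finrank ℂ (highestWeightSpace (Res (sl2Incl 3) (Q0χ χ)) k) =
        k + 1 - 2 * ((k + 2) / 3) := by
  obtain ⟨φ, hφ⟩ := exists_bijective_seminvOfWeight k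
  have hfin : Finite (SeminvOfWeight k) := Finite.of_surjective φ hφ.2
  have hli : LinearIndependent ℂ fun x : SeminvOfWeight k => projQ0χ χ (seminv x.1) :=
    (linearIndependent_seminv χ).comp _ Subtype.val_injective
  let B := Module.Basis.span hli
  rw [highestWeightSpace_Q0χ]
  refine ⟨Module.Finite.of_basis B, ?_⟩
  rw [Module.finrank_eq_nat_card_basis B, ← Nat.card_eq_of_bijective φ hφ, Nat.card_fin]

theorem multiplicity_formula (k : ℕ) :
    ((k + 1 - 2 * ((k + 2) / 3) : ℕ) : ℤ) = (k : ℤ) - 2 * ⌊((k : ℚ) + 2) / 3⌋ + 1 := by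
  have h : ⌊((k : ℚ) + 2) / 3⌋ = (((k + 2) / 3 : ℕ) : ℤ) := by
    have := Rat.floor_natCast_div_natCast (k + 2) 3
    push_cast at this ⊢
    exact this
  rw [h]
  omega

end HighestWeight

/-! ### Infinite-dimensional simple quotients -/

section SimpleQuotient

open MvPolynomial

/-- Submodules of the polynomial model are ideals, because `L(3)` acts by multiplication by the
variables. -/
theorem mul_mem_of_lieSubmodule (W : LieSubmodule ℂ (Galilei 3) CubicPoly) {p : CubicPoly}
    (hp : p ∈ W) (q : CubicPoly) : q * p ∈ W := by
  rw [← actU_polyToU]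
  exact actU_mem W _ hp

variable (χ : ℂ)

theorem polyToQ0χ_one_ne_zero : polyToQ0χ χ 1 ≠ 0 := by
  have h := (linearIndependent_seminv χ).ne_zero (Sum.inl 0)
  rw [seminv_inl] at h
  have h' : projQ0χ χ 1 ≠ 0 := by simpa using h
  exact h'

theorem lieSpan_polyToQ0χ_one :
    LieSubmodule.lieSpan ℂ (Galilei 3) {polyToQ0χ χ 1} = ⊤ := by
  rw [eq_top_iff]
  intro q _
  obtain ⟨p, rfl⟩ := polyToQ0χ_surjective χ q
  have h1 : (1 : CubicPoly) ∈
      (LieSubmodule.lieSpan ℂ (Galilei 3) {polyToQ0χ χ 1}).comap (polyToQ0χ χ) :=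
    LieSubmodule.subset_lieSpan (Set.mem_singleton _)
  have h2 := mul_mem_of_lieSubmodule _ h1 p
  rw [mul_one] at h2
  exact h2

/-- A nonzero cyclic module has a maximal submodule: the top submodule is generated by one element,
hence compact, so the lattice is coatomic. -/
theorem exists_isCoatom_Q0χ : ∃ N : LieSubmodule ℂ (Galilei 3) (Q0χ χ), IsCoatom N := by
  have hc : IsCompactElement (⊤ : LieSubmodule ℂ (Galilei 3) (Q0χ χ)) := by
    rw [← lieSpan_polyToQ0χ_one χ]
    exact LieSubmodule.isCompactElement_lieSpan_singleton ℂ (Galilei 3) _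
  have := CompleteLattice.coatomic_of_top_compact hc
  obtain h | ⟨N, hN, -⟩ :=
    eq_top_or_exists_le_coatom (⊥ : LieSubmodule ℂ (Galilei 3) (Q0χ χ))
  · have h1 : polyToQ0χ χ 1 ∈ (⊥ : LieSubmodule ℂ (Galilei 3) (Q0χ χ)) :=
      h ▸ LieSubmodule.mem_top _
    exact absurd ((LieSubmodule.mem_bot _).1 h1) (polyToQ0χ_one_ne_zero χ)
  · exact ⟨N, hN⟩

theorem isIrreducible_quotient_of_isCoatom {L M : Type} [LieRing L] [LieAlgebra ℂ L]
    [AddCommGroup M] [Module ℂ M] [LieRingModule L M] [LieModule ℂ L M] {N : LieSubmodule ℂ L M}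
    (hN : IsCoatom N) : LieModule.IsIrreducible ℂ L (M ⧸ N) := by
  have hsurj := LieSubmodule.Quotient.surjective_mk' N
  have hnt : Nontrivial (M ⧸ N) := by
    by_contra hc
    rw [not_nontrivial_iff_subsingleton] at hc
    refine hN.1 (eq_top_iff.2 fun m _ => ?_)
    exact (LieSubmodule.Quotient.mk_eq_zero N).1 (Subsingleton.elim (α := M ⧸ N) _ _)
  refine LieModule.IsIrreducible.mk fun K hK => ?_
  have hle : N ≤ K.comap (LieSubmodule.Quotient.mk' N) := fun m hm => by
    have h0 : LieSubmodule.Quotient.mk' N m = 0 := (LieSubmodule.Quotient.mk_eq_zero N).2 hm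
    change LieSubmodule.Quotient.mk' N m ∈ K
    rw [h0]
    exact zero_mem K
  have htop : K.comap (LieSubmodule.Quotient.mk' N) = ⊤ := by
    refine hN.2 _ (lt_of_le_of_ne hle fun heq => hK ((LieSubmodule.eq_bot_iff K).2 fun q hq => ?_))
    obtain ⟨m, rfl⟩ := hsurj q
    have : m ∈ N := by
      rw [heq]
      exact hq
    exact (LieSubmodule.Quotient.mk_eq_zero N).2 this
  rw [eq_top_iff]
  intro q _
  obtain ⟨m, rfl⟩ := hsurj q
  have : m ∈ K.comap (LieSubmodule.Quotient.mk' N) := htop ▸ LieSubmodule.mem_top m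
  exact this

theorem isHarishChandra_Q0χ : IsHarishChandra (sl2Incl 3) (Q0χ χ) :=
  (isIntegrable_Q0χ χ).exists_decomposition_finite fun k =>
    (finrank_highestWeightSpace_Q0χ χ k).1

theorem isHarishChandra_quotient (N : LieSubmodule ℂ (Galilei 3) (Q0χ χ)) :
    IsHarishChandra (sl2Incl 3) (Q0χ χ ⧸ N) := by
  let φ := resHom (LieSubmodule.Quotient.mk' N)
  have hφ : Function.Surjective φ := LieSubmodule.Quotient.surjective_mk' N
  refine ((isIntegrable_Q0χ χ).of_surjective φ hφ).exists_decomposition_finite fun k => ?_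
  have := (finrank_highestWeightSpace_Q0χ χ k).1
  exact (isIntegrable_Q0χ χ).finite_highestWeightSpace_of_surjective φ hφ k

/-- The powers of `p` have the pairwise distinct weights `nμ`. If all images were nonzero they would
be infinitely many independent vectors. -/
theorem exists_map_pow_eq_zero {M : Type} [AddCommGroup M] [Module ℂ M] [LieRingModule Sl2 M]
    [LieModule ℂ Sl2 M] [Module.Finite ℂ M] (φ : CubicPoly →ₗ⁅ℂ,Sl2⁆ M) {μ : ℂ} (hμ : μ ≠ 0)
    {p : CubicPoly} (hp : p ∈ weightSpace CubicPoly μ) : ∃ n : ℕ, φ (p ^ n) = 0 := by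
  by_contra! hc
  have hli : LinearIndependent ℂ fun n : ℕ => φ (p ^ n) := by
    refine Module.End.eigenvectors_linearIndependent' (LieModule.toEnd ℂ Sl2 M Sl2.h)
      (fun n : ℕ => (n : ℂ) * μ) (fun m n hmn => ?_) _ fun n =>
        ⟨map_weightSpace_le φ _ ⟨_, pow_mem_weightSpace hp n, rfl⟩, hc n⟩
    exact Nat.cast_injective (mul_right_cancel₀ hμ hmn)
  have := hli.finite
  exact not_finite ℕ

/-- Geometrically, a finite-dimensional quotient would be supported at the origin, since the
variables have odd, hence nonzero, weights and become nilpotent. But the origin is not on the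
hypersurface `D = χ` when `χ ≠ 0`. -/
theorem not_finite_of_nontrivial_quotient (hχ : χ ≠ 0) (N : LieSubmodule ℂ (Galilei 3) (Q0χ χ))
    (hN : N ≠ ⊤) : ¬ Module.Finite ℂ (Q0χ χ ⧸ N) := by
  intro hfin
  have hfin' : Module.Finite ℂ (Res (sl2Incl 3) (Q0χ χ ⧸ N)) := hfin
  let φ : CubicPoly →ₗ⁅ℂ,Galilei 3⁆ Q0χ χ ⧸ N :=
    (LieSubmodule.Quotient.mk' N).comp (polyToQ0χ χ)
  let J : Ideal CubicPoly :=
    { carrier := {p | φ p = 0}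
      add_mem' := fun {p q} hp hq => by
        change φ (p + q) = 0
        rw [map_add, show φ p = 0 from hp, show φ q = 0 from hq, add_zero]
      zero_mem' := map_zero φ
      smul_mem' := fun c p hp => by
        have : c * p ∈ φ.ker := mul_mem_of_lieSubmodule _ (LieModuleHom.mem_ker.2 hp) c
        exact LieModuleHom.mem_ker.1 this }
  have hX : ∀ j, (X j : CubicPoly) ∈ J.radical := fun j => by
    have hμ : ((3 : ℂ) - 2 * (j.1 : ℂ)) ≠ 0 := by
      rw [sub_ne_zero]
      have : 3 ≠ 2 * j.1 := by omega
      exact_mod_cast this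
    obtain ⟨n, hn⟩ := exists_map_pow_eq_zero (resHom φ) hμ (X_mem_weightSpace j)
    exact ⟨n, hn⟩
  have hD : discPoly ∈ J.radical := by
    have h1 := J.radical.mul_mem_left (X 2 ^ 2 * X 1) (hX 1)
    have h2 := J.radical.mul_mem_left (27 * X 3 ^ 2 * X 0) (hX 0)
    have h3 := J.radical.mul_mem_left (4 * X 2 ^ 3) (hX 0)
    have h4 := J.radical.mul_mem_left (4 * X 3 * X 1 ^ 2) (hX 1)
    have h5 := J.radical.mul_mem_left (18 * X 3 * X 2 * X 1) (hX 0)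
    have := add_mem (sub_mem (sub_mem (sub_mem h1 h2) h3) h4) h5
    convert this using 1
    rw [discPoly]
    ring
  have hDχ : discPoly - C χ ∈ J.radical := by
    refine Ideal.le_radical ?_
    change LieSubmodule.Quotient.mk' N (polyToQ0χ χ (discPoly - C χ)) = 0
    rw [(polyToQ0χ_eq_zero_iff χ _).2 dvd_rfl, map_zero]
  have hC : C χ ∈ J.radical := by
    have := sub_mem hD hDχ
    rwa [sub_sub_cancel] at this
  have htop : J = ⊤ := by
    rw [← Ideal.radical_eq_top]
    exact Ideal.eq_top_of_isUnit_mem _ hC ((IsUnit.mk0 χ hχ).map C)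
  refine hN (eq_top_iff.2 fun q _ => ?_)
  obtain ⟨p, rfl⟩ := polyToQ0χ_surjective χ q
  have hp : p ∈ J := htop ▸ Submodule.mem_top
  exact (LieSubmodule.Quotient.mk_eq_zero N).1 hp

end SimpleQuotient

/-! ### The zero weight space of the radical -/

section Radical

/-- The quadratic form is minus the determinant. If it vanished on `𝔥`, then `𝔥` would consist of
nilpotent matrices and be totally isotropic. An element on which the form is nonzero then normalises
`𝔥`, against self-normalisation. -/
theorem exists_disc_ne_zero_of_isCartanSubalgebra (𝔥 : LieSubalgebra ℂ Sl2)
    (h𝔥 : 𝔥.IsCartanSubalgebra) :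
    ∃ x ∈ 𝔥, x.1 0 0 * x.1 0 0 + x.1 0 1 * x.1 1 0 ≠ 0 := by
  by_contra! hc
  have hnorm : ∀ t : Sl2, (∀ y ∈ 𝔥, ⁅t, y⁆ ∈ 𝔥) → t ∈ 𝔥 := fun t ht => by
    rw [← h𝔥.self_normalizing, LieSubalgebra.mem_normalizer_iff]
    exact ht
  have hpol : ∀ x ∈ 𝔥, ∀ y ∈ 𝔥,
      2 * x.1 0 0 * y.1 0 0 + x.1 0 1 * y.1 1 0 + y.1 0 1 * x.1 1 0 = 0 := fun x hx y hy => by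
    have h1 := hc x hx
    have h2 := hc y hy
    have h3 : (x.1 0 0 + y.1 0 0) * (x.1 0 0 + y.1 0 0) +
        (x.1 0 1 + y.1 0 1) * (x.1 1 0 + y.1 1 0) = 0 := hc (x + y) (add_mem hx hy)
    linear_combination h3 - h1 - h2
  have hh : Sl2.h ∉ 𝔥 := fun h => by
    have := hc _ h
    simp [Sl2.h] at this
  by_cases hq : ∃ x ∈ 𝔥, x.1 0 1 ≠ 0
  · obtain ⟨x, hx, hx0⟩ := hq
    -- The coefficient of `f` is found by solving `⁅t, x⁆ = 2x` with `t` lower triangular and upper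
    -- left entry `1`; the form takes the value `1` at `t`.
    let t : Sl2 := Sl2.h + (-2 * x.1 0 0 / x.1 0 1) • Sl2.f
    have ht0 : t.1 0 0 = 1 := by
      change (1 : ℂ) + (-2 * x.1 0 0 / x.1 0 1) * 0 = 1
      ring
    have ht1 : t.1 0 1 = 0 := by
      change (0 : ℂ) + (-2 * x.1 0 0 / x.1 0 1) * 0 = 0
      ring
    have ht2 : t.1 1 0 = -2 * x.1 0 0 / x.1 0 1 := by
      change (0 : ℂ) + (-2 * x.1 0 0 / x.1 0 1) * 1 = _
      ring
    have ht : t ∈ 𝔥 := by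
      refine hnorm t fun y hy => ?_
      have hty : ⁅t, y⁆ = (2 : ℂ) • y := by
        have h1 := hc x hx
        have h2 := hc y hy
        have h3 := hpol x hx y hy
        -- The form vanishes at the combination of `x` and `y` whose upper right entry is zero, and
        -- its value there is the square of the diagonal entry.
        have h4 : (x.1 0 1 * y.1 0 0 - y.1 0 1 * x.1 0 0) ^ 2 = 0 := by
          linear_combination x.1 0 1 ^ 2 * h2 + y.1 0 1 ^ 2 * h1 - x.1 0 1 * y.1 0 1 * h3
        have h5 : x.1 0 1 * y.1 0 0 - y.1 0 1 * x.1 0 0 = 0 := by simpa using h4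
        apply Sl2.ext_entries
        · rw [LieAlgebra.SpecialLinear.sl_bracket]
          change _ = 2 * y.1 0 0
          simp only [Matrix.sub_apply, Matrix.mul_apply, Fin.sum_univ_two, ht0, ht1, ht2]
          field_simp
          linear_combination (-2 : ℂ) * h5
        · rw [LieAlgebra.SpecialLinear.sl_bracket]
          change _ = 2 * y.1 0 1
          simp only [Matrix.sub_apply, Matrix.mul_apply, Fin.sum_univ_two, ht0, ht1,
            Sl2.apply_one_one t]
          ring
        · rw [LieAlgebra.SpecialLinear.sl_bracket]
          change _ = 2 * y.1 1 0
          simp only [Matrix.sub_apply, Matrix.mul_apply, Fin.sum_univ_two, ht0, ht2,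
            Sl2.apply_one_one t, Sl2.apply_one_one y]
          field_simp
          have h6 : x.1 0 0 * y.1 0 0 + y.1 0 1 * x.1 1 0 = 0 :=
            mul_left_cancel₀ hx0
              (by linear_combination x.1 0 0 * h5 + y.1 0 1 * h1)
          linear_combination (-4 : ℂ) * h3 + 4 * h6
      rw [hty]
      exact 𝔥.smul_mem _ hy
    have := hc t ht
    rw [ht0, ht1] at this
    simp at this
  · push Not at hq
    refine hh (hnorm _ fun y hy => ?_)
    have h1 := hc y hy
    rw [hq y hy, zero_mul, add_zero, mul_self_eq_zero] at h1
    have hy' : y = y.1 1 0 • Sl2.f := by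
      conv_lhs => rw [Sl2.eq_combination y]
      rw [h1, hq y hy, zero_smul, zero_smul, zero_add, zero_add]
    have hty : ⁅Sl2.h, y⁆ = (-2 : ℂ) • y := by
      rw [hy', lie_smul, Sl2.lie_h_f, smul_comm]
    rw [hty]
    exact 𝔥.smul_mem _ hy

/-- With `δ = p² + qr`, the element `x` acts on `L(3)` with eigenvalues `±√δ` and `±3√δ`, hence with
determinant `9δ²`. -/
theorem eq_zero_of_lie_eq_zero {x : Sl2} (hx : x.1 0 0 * x.1 0 0 + x.1 0 1 * x.1 1 0 ≠ 0)
    {w : Irrep 3} (hw : ⁅x, w⁆ = 0) : w = 0 := by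
  have e : ∀ j < 4, _ := fun j hj => (Irrep.coord_act 3 x w j hj).symm.trans
    ((congrArg (fun u => Irrep.coord u j) hw).trans (Irrep.coord_zero j))
  have e0 := e 0 (by norm_num)
  have e1 := e 1 (by norm_num)
  have e2 := e 2 (by norm_num)
  have e3 := e 3 (by norm_num)
  have w4 : Irrep.coord w 4 = 0 := by simp [Irrep.coord]
  norm_num [w4] at e0 e1 e2 e3
  generalize x.1 0 0 = p at *
  generalize x.1 0 1 = q at *
  generalize x.1 1 0 = r at *
  have hδ : (p * p + q * r) ^ 2 ≠ 0 := pow_ne_zero 2 hx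
  refine Irrep.ext_coord fun j hj => mul_left_cancel₀ hδ ?_
  rw [Irrep.coord_zero, mul_zero]
  interval_cases j
  -- The coefficients are the rows of `δ² x⁻¹ = (10 δ x - x³)/9`, from the characteristic equation
  -- `x⁴ - 10 δ x² + 9 δ² = 0` on `L(3)`.
  · linear_combination (p ^ 3 / 3 + p * q * r) * e0 + (-p ^ 2 * q + q ^ 2 * r) * e1 -
      2 * p * q ^ 2 * e2 - 2 / 3 * q ^ 3 * e3
  · linear_combination (-p ^ 2 * r / 3 + q * r ^ 2 / 3) * e0 + (p ^ 3 - p * q * r) * e1 +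
      2 * p ^ 2 * q * e2 + 2 / 3 * p * q ^ 2 * e3
  · linear_combination -2 / 3 * p * r ^ 2 * e0 + 2 * p ^ 2 * r * e1 + (-p ^ 3 + p * q * r) * e2 +
      (-p ^ 2 * q / 3 + q ^ 2 * r / 3) * e3
  · linear_combination -2 / 3 * r ^ 3 * e0 + 2 * p * r ^ 2 * e1 + (-p ^ 2 * r + q * r ^ 2) * e2 +
      (-p ^ 3 / 3 - p * q * r) * e3

instance : Module.Finite ℂ (Galilei 3) :=
  Module.Finite.equiv (LieAlgebra.SemiDirectSum.toProdl (Irrep.derivation 3)).symm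

/-- The image of an ideal is an ideal of the simple algebra `sl₂`. Concretely, bracketing a nonzero
element with `e` at most twice gives a nonzero multiple of `e`, which generates everything. -/
theorem projr_surjective_of_mem {I : LieIdeal ℂ (Galilei 3)} {x : Galilei 3} (hx : x ∈ I)
    (h0 : x.right ≠ 0) (y : Sl2) : ∃ z ∈ I, z.right = y := by
  let K : Submodule ℂ Sl2 :=
    I.toSubmodule.map (LieAlgebra.SemiDirectSum.projr (Irrep.derivation 3) : Galilei 3 →ₗ[ℂ] Sl2)
  have hK : ∀ (u v : Sl2), v ∈ K → ⁅u, v⁆ ∈ K := by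
    rintro u _ ⟨z, hz, rfl⟩
    exact ⟨⁅sl2Incl 3 u, z⁆, I.lie_mem hz, rfl⟩
  have hxK : x.right ∈ K := ⟨x, hx, rfl⟩
  set v := x.right with hv
  have hef : ⁅Sl2.e, Sl2.h⁆ = (-2 : ℂ) • Sl2.e := by
    rw [← lie_skew, Sl2.lie_h_e, neg_smul]
  have h1 : ⁅Sl2.e, v⁆ = v.1 1 0 • Sl2.h + (-2 * v.1 0 0) • Sl2.e := by
    conv_lhs => rw [Sl2.eq_combination v]
    rw [lie_add, lie_add, lie_smul, lie_smul, lie_smul, hef, lie_self, Sl2.lie_e_f, smul_zero,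
      add_zero, smul_smul, add_comm, mul_comm]
  have h2 : ⁅Sl2.e, ⁅Sl2.e, v⁆⁆ = (-2 * v.1 1 0) • Sl2.e := by
    rw [h1, lie_add, lie_smul, lie_smul, hef, lie_self, smul_zero, add_zero, smul_smul, mul_comm]
  have hcancel : ∀ (c : ℂ) (u : Sl2), c ≠ 0 → c • u ∈ K → u ∈ K := fun c u hc hu => by
    have := K.smul_mem c⁻¹ hu
    rwa [smul_smul, inv_mul_cancel₀ hc, one_smul] at this
  have he : Sl2.e ∈ K := by
    by_cases hr : v.1 1 0 = 0
    · by_cases hp : v.1 0 0 = 0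
      · have hve : v = v.1 0 1 • Sl2.e := by
          conv_lhs => rw [Sl2.eq_combination v]
          rw [hr, hp, zero_smul, zero_smul, zero_add, add_zero]
        refine hcancel (v.1 0 1) _ (fun hq => h0 ?_) (hve ▸ hxK)
        rw [hve, hq, zero_smul]
      · refine hcancel (-2 * v.1 0 0) _ (by simp [hp]) ?_
        have := hK Sl2.e v hxK
        rwa [h1, hr, zero_smul, zero_add] at this
    · refine hcancel (-2 * v.1 1 0) _ (by simp [hr]) ?_
      rw [← h2]
      exact hK _ _ (hK _ _ hxK)
  have hh : Sl2.h ∈ K := by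
    have := hK Sl2.f _ he
    rw [← lie_skew, Sl2.lie_e_f] at this
    exact neg_mem_iff.1 this
  have hf : Sl2.f ∈ K := by
    have := hK Sl2.f _ hh
    rw [← lie_skew, Sl2.lie_h_f, ← neg_smul] at this
    exact hcancel _ _ (by norm_num) this
  have hy : y ∈ K := by
    rw [Sl2.eq_combination y]
    exact add_mem (add_mem (K.smul_mem _ hh) (K.smul_mem _ he)) (K.smul_mem _ hf)
  obtain ⟨z, hz, hzy⟩ := hy
  exact ⟨z, hz, hzy⟩

/-- If the radical had a nonzero image in `sl₂`, every term of its derived series would surject onto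
`sl₂`, because `h = ⁅e, f⁆` gives the next term a nonzero image again. This contradicts solvability.
-/
theorem right_eq_zero_of_mem_radical {x : Galilei 3} (hx : x ∈ LieAlgebra.radical ℂ (Galilei 3)) :
    x.right = 0 := by
  by_contra h0
  set R := LieAlgebra.radical ℂ (Galilei 3) with hR
  have key : ∀ k : ℕ, ∃ z ∈ LieAlgebra.derivedSeriesOfIdeal ℂ (Galilei 3) k R, z.right ≠ 0 := by
    intro k
    induction k with
    | zero => exact ⟨x, hx, h0⟩
    | succ k ih =>
      obtain ⟨z, hz, hz0⟩ := ih
      obtain ⟨u, hu, hue⟩ := projr_surjective_of_mem hz hz0 Sl2.e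
      obtain ⟨v, hv, hvf⟩ := projr_surjective_of_mem hz hz0 Sl2.f
      refine ⟨⁅u, v⁆, ?_, ?_⟩
      · rw [LieAlgebra.derivedSeriesOfIdeal_succ]
        exact LieSubmodule.lie_mem_lie hu hv
      · change ⁅u.right, v.right⁆ ≠ 0
        rw [hue, hvf, Sl2.lie_e_f]
        intro h
        have := congrArg (fun y : Sl2 => y.1 0 0) h
        simp [Sl2.h] at this
  obtain ⟨k, hk⟩ := (LieAlgebra.isSolvable_iff ℂ R).1 (LieAlgebra.radicalIsSolvable ℂ (Galilei 3))
  rw [LieIdeal.derivedSeries_eq_bot_iff] at hk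
  obtain ⟨z, hz, hz0⟩ := key k
  rw [hk, LieSubmodule.mem_bot] at hz
  rw [hz] at hz0
  exact hz0 rfl

/-- Stronger than the final claim, which only concerns the intersection with `[L³, r]`: the radical
lies in `L(3)`, where some element of `𝔥` acts injectively. -/
theorem radicalZeroWeightSpace_eq_bot (𝔥 : LieSubalgebra ℂ Sl2) (h𝔥 : 𝔥.IsCartanSubalgebra) :
    radicalZeroWeightSpace (sl2Incl 3) 𝔥 = ⊥ := by
  rw [eq_bot_iff]
  rintro ⟨w, y⟩ ⟨hrad, hzero⟩
  obtain rfl : y = 0 := right_eq_zero_of_mem_radical hrad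
  obtain ⟨x, hx, hx0⟩ := exists_disc_ne_zero_of_isCartanSubalgebra 𝔥 h𝔥
  have h1 := congrArg LieAlgebra.SemiDirectSum.left (hzero x hx)
  change ⁅(0 : Irrep 3), w⁆ + ⁅x, w⁆ - ⁅(0 : Sl2), (0 : Irrep 3)⁆ = 0 at h1
  rw [zero_lie, zero_lie, zero_add, sub_zero] at h1
  obtain rfl := eq_zero_of_lie_eq_zero hx0 h1
  exact Submodule.zero_mem _

end Radical

end HarishChandra

end

open HarishChandra in
theorem proposition7p1 :
    (∀ χ : ℂ, χ ≠ 0 →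
      IsHarishChandra (sl2Incl 3) (Q0χ χ) ∧
      (∀ s : Set (LieSubmodule ℂ Sl2 (Res (sl2Incl 3) (Q0χ χ))), IsSimpleDecomposition s →
        ∀ k : ℕ, (summandsOfType s (Irrep k)).Finite ∧
          ((summandsOfType s (Irrep k)).ncard : ℤ) = (k : ℤ) - 2 * ⌊((k : ℚ) + 2) / 3⌋ + 1) ∧
      (∃ N : LieSubmodule ℂ (Galilei 3) (Q0χ χ),
        LieModule.IsIrreducible ℂ (Galilei 3) (Q0χ χ ⧸ N) ∧
        ¬ Module.Finite ℂ (Q0χ χ ⧸ N) ∧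
        IsHarishChandra (sl2Incl 3) (Q0χ χ ⧸ N))) ∧
    (∀ 𝔥 : LieSubalgebra ℂ Sl2, 𝔥.IsCartanSubalgebra →
      (⁅(⊤ : LieIdeal ℂ (Galilei 3)), LieAlgebra.radical ℂ (Galilei 3)⁆).toSubmodule ⊓
        radicalZeroWeightSpace (sl2Incl 3) 𝔥 = ⊥) := by
  refine ⟨fun χ hχ => ⟨isHarishChandra_Q0χ χ, fun s hs k => ?_, ?_⟩, fun 𝔥 h𝔥 => ?_⟩
  · obtain ⟨hfin, hrank⟩ := finrank_highestWeightSpace_Q0χ χ k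
    obtain ⟨h1, h2⟩ := hs.ncard_summandsOfType (isIntegrable_Q0χ χ) k
    exact ⟨h1, by rw [h2, hrank, multiplicity_formula]⟩
  · obtain ⟨N, hN⟩ := exists_isCoatom_Q0χ χ
    exact ⟨N, isIrreducible_quotient_of_isCoatom hN,
      not_finite_of_nontrivial_quotient χ hχ N hN.1, isHarishChandra_quotient χ N⟩
  · rw [radicalZeroWeightSpace_eq_bot 𝔥 h𝔥, inf_bot_eq]
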